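/- For a real-valued function $\varphi$ on a domain $D\subset\mathbb C^n$ let $L^2(D,\varphi)$ and $L^2_{(0,1)}(D,\varphi)$ be the Hilbert spaces of functions $u$, respectively $(0,1)$-forms $f=\sum_j f_j\,d\bar z_j$, with $\|u\|_\varphi^2=\int_D|u|^2e^{-\varphi}d\lambda<\infty$, respectively $\|f\|_\varphi^2=\int_D\sum_j|f_j|^2e^{-\varphi}d\lambda<\infty$; $\bar\partial$ is taken in the sense of distributions, and as an operator $L^2(D,\varphi)\to L^2_{(0,1)}(D,\varphi)$ it has its maximal domain. For $\psi:D\to\mathbb R$, the pair $(D,\psi)$ is called $L^2$-optimal if for every smooth strictly plurisubharmonic function $\phi$ on $\mathbb C^n$ and every $\bar\partial$-closed $f\in L^2_{(0,1)}(D,\phi+\psi)$ there is a solution $u$ of $\bar\partial u=f$ on $D$ with $$\int_D|u|^2e^{-\phi-\psi}d\lambda\le\int_D\langle B_\phi^{-1}f,f\rangle e^{-\phi-\psi}d\lambda,\qquad B_\phi f=\sum_{j,k}\frac{\partial^2\phi}{\partial z_j\partial\bar z_k}f_j\,d\bar z_k,$$ provided the right-hand side is finite. **Theorem.** Let $D\subset\mathbb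 C^n$ be a domain and let $g=(g_1,\dots,g_p)$ be holomorphic functions on $D$ with $0<\inf_D|g|^2\le\sup_D|g|^2<\infty$ and $\sup_D|\partial g|^2<\infty$, where $|g|^2=\sum_i|g_i|^2$ and $|\partial g|^2=\sum_{i,k}|\partial g_i/\partial z_k|^2$. Then there are $a_0>0$ and $\delta>0$, depending only on $D$ and $g$, such that for every $a\ge a_0$, with $\phi(z)=a\|z\|^2$, and for every upper semi-continuous $\psi:D\to\mathbb R$ such that $(D,\psi)$ is $L^2$-optimal, the following hold. 1. Suppose that $\psi$ is continuous. Let $T_1:L^2(D,\phi+\psi)^{\oplus p}\to L^2(D,\phi+\psi)$, $T_1h=\sum_ig_ih_i$, and let $T_2:L^2(D,\phi+\psi)^{\oplus p}\to L^2_{(0,1)}(D,\phi+\psi)^{\oplus p}$, $T_2h=(\bar\partial h_1,\dots,\bar\partial h_p)$, a closed densely defined operator. Then $$\|T_1^*u+T_2^*v\|_{\phi+\psi}^2\ge\delta\,\|u\|_{\phi+\psi}^2$$ for all $u\in L^2(D,\phi+\psi)$ with $\bar\partial u=0$ and all $v\in\mathrm{Dom}(T_2^*)\cap(\mathrm{Ker}\,T_2^*)^\perp$.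 2. For every holomorphic $f\in L^2(D,\phi+\psi)$ there are holomorphic $h_1,\dots,h_p\in L^2(D,\phi+\psi)$ with $f=\sum_{i=1}^ph_ig_i$ on $D$. -/

import Mathlib

namespace L2Division

open MeasureTheory
open scoped ENNReal ContDiff ComplexOrder

variable {n p : ℕ}

/-! Points of `ℂⁿ` are functions `Fin n → ℂ`, with the Lebesgue measure `volume`. The Euclidean
norm is always written out as `∑ i, ‖z i‖ ^ 2`; the sup norm of `Fin n → ℂ` is only used through
the topology and the notion of derivative, for which the choice of norm is immaterial. -/

/-- The Wirtinger derivative `∂F/∂z_j`. -/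
noncomputable def dz (j : Fin n) (F : (Fin n → ℂ) → ℂ) (z : Fin n → ℂ) : ℂ :=
  (1 / 2 : ℂ) * (fderiv ℝ F z (Pi.single j 1) - Complex.I * fderiv ℝ F z (Pi.single j Complex.I))

/-- The Wirtinger derivative `∂F/∂z̄_j`. -/
noncomputable def dzbar (j : Fin n) (F : (Fin n → ℂ) → ℂ) (z : Fin n → ℂ) : ℂ :=
  (1 / 2 : ℂ) * (fderiv ℝ F z (Pi.single j 1) + Complex.I * fderiv ℝ F z (Pi.single j Complex.I))

/-- The measure `e^{-φ} dλ` on `D`; `L²(D, φ)` is `L²` of this measure. -/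
noncomputable def weightedMeasure (D : Set (Fin n → ℂ)) (φ : (Fin n → ℂ) → ℝ) :
    Measure (Fin n → ℂ) :=
  (volume.restrict D).withDensity fun z => ENNReal.ofReal (Real.exp (-φ z))

/-- Smooth complex valued functions with compact support in `D`. -/
def IsTestFunction (D : Set (Fin n → ℂ)) (χ : (Fin n → ℂ) → ℂ) : Prop :=
  ContDiff ℝ ∞ χ ∧ HasCompactSupport χ ∧ tsupport χ ⊆ D

/-- `∂̄u = f = ∑ f_j dz̄_j` on `D` in the sense of distributions, for locally integrable `u, f`. -/
def IsWeakDbar (D : Set (Fin n → ℂ)) (u : (Fin n → ℂ) → ℂ) (f : Fin n → (Fin n → ℂ) → ℂ) : Prop :=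
  LocallyIntegrableOn u D volume ∧ (∀ j, LocallyIntegrableOn (f j) D volume) ∧
    ∀ χ, IsTestFunction D χ → ∀ j,
      ∫ z in D, u z * dzbar j χ z = -∫ z in D, f j z * χ z

/-- The `(0,1)`-form `∑ f_j dz̄_j` is `∂̄`-closed on `D` in the sense of distributions:
`∂f_j/∂z̄_k = ∂f_k/∂z̄_j` for all `j, k`. -/
def IsDbarClosed (D : Set (Fin n → ℂ)) (f : Fin n → (Fin n → ℂ) → ℂ) : Prop :=
  (∀ j, LocallyIntegrableOn (f j) D volume) ∧
    ∀ χ, IsTestFunction D χ → ∀ j k,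
      ∫ z in D, f j z * dzbar k χ z = ∫ z in D, f k z * dzbar j χ z

/-- The matrix of the operator `B_φ` on `(0,1)`-forms at `z`: the coefficient of `dz̄_k` in `B_φ f`
is `∑ j, (∂²φ/∂z_j∂z̄_k) f_j`. -/
noncomputable def curvatureMatrix (φ : (Fin n → ℂ) → ℝ) (z : Fin n → ℂ) :
    Matrix (Fin n) (Fin n) ℂ :=
  Matrix.of fun k j => dz j (dzbar k fun w => (φ w : ℂ)) z

/-- `φ` is a smooth strictly plurisubharmonic function on `ℂⁿ`: its Levi form
`∑ (∂²φ/∂z_j∂z̄_k) ξ_j ξ̄_k` is positive definite at every point. -/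
def IsSmoothStrictlyPsh (φ : (Fin n → ℂ) → ℝ) : Prop :=
  ContDiff ℝ ∞ φ ∧ ∀ z, (curvatureMatrix φ z).PosDef

/-- `⟨B_φ⁻¹ f, f⟩` at the point `z`. -/
noncomputable def curvatureInvForm (φ : (Fin n → ℂ) → ℝ) (f : Fin n → (Fin n → ℂ) → ℂ)
    (z : Fin n → ℂ) : ℝ :=
  (∑ k, ((curvatureMatrix φ z)⁻¹.mulVec fun j => f j z) k * star (f k z)).re

/-- The pair `(D, ψ)` is `L²`-optimal: for every smooth strictly plurisubharmonic `φ` on `ℂⁿ` and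
every `∂̄`-closed `(0,1)`-form `f ∈ L²(D, φ + ψ)`, the equation `∂̄u = f` has a solution on `D` with
`∫_D |u|² e^{-φ-ψ} ≤ ∫_D ⟨B_φ⁻¹ f, f⟩ e^{-φ-ψ}`, provided the right-hand side is finite. -/
def IsL2Optimal (D : Set (Fin n → ℂ)) (ψ : (Fin n → ℂ) → ℝ) : Prop :=
  ∀ φ : (Fin n → ℂ) → ℝ, IsSmoothStrictlyPsh φ →
    ∀ f : Fin n → (Fin n → ℂ) → ℂ,
      (∀ j, MemLp (f j) 2 (weightedMeasure D (φ + ψ))) → IsDbarClosed D f →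
      ∫⁻ z, ENNReal.ofReal (curvatureInvForm φ f z) ∂weightedMeasure D (φ + ψ) < ⊤ →
      ∃ u : (Fin n → ℂ) → ℂ, MemLp u 2 (weightedMeasure D (φ + ψ)) ∧ IsWeakDbar D u f ∧
        ∫⁻ z, ‖u z‖ₑ ^ 2 ∂weightedMeasure D (φ + ψ) ≤
          ∫⁻ z, ENNReal.ofReal (curvatureInvForm φ f z) ∂weightedMeasure D (φ + ψ)

/-- The Hilbert space `L²(D, φ)`. -/
abbrev L2 (D : Set (Fin n → ℂ)) (φ : (Fin n → ℂ) → ℝ) : Type :=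
  Lp ℂ 2 (weightedMeasure D φ)

/-- The Hilbert space `L²_{(0,1)}(D, φ)` of `(0,1)`-forms `∑ f_j dz̄_j`. -/
abbrev L2Form (D : Set (Fin n → ℂ)) (φ : (Fin n → ℂ) → ℝ) : Type :=
  PiLp 2 fun _ : Fin n => L2 D φ

theorem IsTestFunction.continuous_dzbar {D : Set (Fin n → ℂ)} {χ : (Fin n → ℂ) → ℂ}
    (h : IsTestFunction D χ) (j : Fin n) : Continuous (dzbar j χ) := by
  have h1 : Continuous (fderiv ℝ χ) := h.1.continuous_fderiv (by simp)
  unfold dzbar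
  fun_prop

theorem support_dzbar {χ : (Fin n → ℂ) → ℂ} (j : Fin n) : Function.support (dzbar j χ) ⊆ tsupport χ := by
  intro z hz
  by_contra h
  apply hz
  have : fderiv ℝ χ z = 0 := by
    by_contra h'
    exact h (support_fderiv_subset ℝ h')
  simp [dzbar, this]

/-- A locally integrable function times a continuous function supported in a compact subset of `D`
is integrable on `D`. -/
theorem integrable_mul_of_support {D : Set (Fin n → ℂ)} {u w : (Fin n → ℂ) → ℂ}
    {χ : (Fin n → ℂ) → ℂ} (h : IsTestFunction D χ)
    (hu : LocallyIntegrableOn u D volume) (hw : Continuous w)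
    (hs : Function.support w ⊆ tsupport χ) :
    Integrable (fun z => u z * w z) (volume.restrict D) := by
  have hK : IntegrableOn (fun z => u z * w z) (tsupport χ) volume :=
    (hu.integrableOn_compact_subset h.2.2 h.2.1).mul_continuousOn hw.continuousOn h.2.1
  have : Integrable (fun z => u z * w z) volume :=
    (integrableOn_iff_integrable_of_support_subset
      ((Function.support_mul_subset_right u w).trans hs)).1 hK
  exact this.restrict

/-- The graph of `∂̄ : L²(D, φ) → L²_{(0,1)}(D, φ)`: pairs with `∂̄u = f` in the sense of
distributions. Elements of `L²` are classes modulo null sets, so the condition is put on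
representatives. -/
def dbarGraph (D : Set (Fin n → ℂ)) (φ : (Fin n → ℂ) → ℝ) :
    Submodule ℂ (L2 D φ × L2Form D φ) where
  carrier := {x | ∃ (u : (Fin n → ℂ) → ℂ) (f : Fin n → (Fin n → ℂ) → ℂ),
    x.1 =ᵐ[weightedMeasure D φ] u ∧ (∀ j, x.2 j =ᵐ[weightedMeasure D φ] f j) ∧ IsWeakDbar D u f}
  zero_mem' := by
    refine ⟨0, 0, Lp.coeFn_zero _ _ _, fun j => Lp.coeFn_zero _ _ _, ?_, fun j => ?_, ?_⟩
    · exact locallyIntegrableOn_zero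
    · exact locallyIntegrableOn_zero
    · intro χ hχ j
      simp
  add_mem' := by
    rintro x y ⟨u, f, hu, hf, hu1, hf1, H⟩ ⟨v, g, hv, hg, hv1, hg1, H'⟩
    refine ⟨u + v, f + g, (Lp.coeFn_add _ _).trans (hu.add hv),
      fun j => (Lp.coeFn_add _ _).trans ((hf j).add (hg j)), hu1.add hv1,
      fun j => (hf1 j).add (hg1 j), fun χ hχ j => ?_⟩
    have hc := hχ.1.continuous
    have hd := hχ.continuous_dzbar j
    have hs := support_dzbar (χ := χ) j
    simp only [Pi.add_apply, add_mul]
    rw [integral_add (integrable_mul_of_support hχ hu1 hd hs)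
        (integrable_mul_of_support hχ hv1 hd hs),
      integral_add (integrable_mul_of_support hχ (hf1 j) hc subset_closure)
        (integrable_mul_of_support hχ (hg1 j) hc subset_closure), H χ hχ j, H' χ hχ j, neg_add]
  smul_mem' := by
    rintro c x ⟨u, f, hu, hf, hu1, hf1, H⟩
    refine ⟨c • u, c • f, (Lp.coeFn_smul _ _).trans (hu.const_smul c),
      fun j => (Lp.coeFn_smul _ _).trans ((hf j).const_smul c), hu1.smul c,
      fun j => (hf1 j).smul c, fun χ hχ j => ?_⟩
    simp only [Pi.smul_apply, smul_eq_mul, mul_assoc]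
    rw [integral_const_mul, integral_const_mul, H χ hχ j, mul_neg]

/-- The densely defined operator `∂̄ : L²(D, φ) → L²_{(0,1)}(D, φ)`, on its maximal domain of all
`u` whose distributional `∂̄u` is in `L²_{(0,1)}(D, φ)`. -/
noncomputable def dbar (D : Set (Fin n → ℂ)) (φ : (Fin n → ℂ) → ℝ) :
    L2 D φ →ₗ.[ℂ] L2Form D φ :=
  (dbarGraph D φ).toLinearPMap

/-- The set `dbarGraph D φ` is the graph of the operator `dbar D φ`. -/
theorem dbar_graph {D : Set (Fin n → ℂ)} (hD : IsOpen D) {φ : (Fin n → ℂ) → ℝ}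
    (hφ : AEMeasurable φ (volume.restrict D)) : (dbar D φ).graph = dbarGraph D φ := by
  apply Submodule.toLinearPMap_graph_eq
  rintro ⟨x, y⟩ ⟨u, f, hu, hf, hu1, hf1, H⟩ rfl
  have hac : volume.restrict D ≪ weightedMeasure D φ :=
    withDensity_absolutelyContinuous' (by fun_prop)
      (Filter.Eventually.of_forall fun z => by simp [Real.exp_pos])
  have hu0 : u =ᵐ[volume.restrict D] 0 :=
    hac.ae_le ((hu.symm.trans (Lp.coeFn_zero _ _ _)))
  ext j : 1
  have hfj : ∀ᵐ z ∂(volume : Measure (Fin n → ℂ)), z ∈ D → f j z = 0 := by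
    refine hD.ae_eq_zero_of_integral_contDiff_smul_eq_zero (hf1 j) fun g hg hgc hgs => ?_
    have hχ : IsTestFunction D fun z => (g z : ℂ) := by
      have hsub : tsupport (fun z => (g z : ℂ)) ⊆ tsupport g :=
        closure_mono fun z hz => by simpa using hz
      exact ⟨Complex.ofRealCLM.contDiff.comp hg,
        hgc.of_isClosed_subset (isClosed_tsupport _) hsub, hsub.trans hgs⟩
    have h1 := H _ hχ j
    have h2 : ∫ z in D, u z * dzbar j (fun z => (g z : ℂ)) z = 0 := by
      refine integral_eq_zero_of_ae (hu0.mono fun z hz => ?_)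
      simp [hz]
    rw [h2, eq_comm, neg_eq_zero] at h1
    rw [← setIntegral_eq_integral_of_forall_compl_eq_zero (s := D), ← h1]
    · exact integral_congr_ae (Filter.Eventually.of_forall fun z => by simp [mul_comm])
    · intro z hz
      have : g z = 0 := image_eq_zero_of_notMem_tsupport fun h => hz (hgs h)
      simp [this]
  have hfj' : f j =ᵐ[weightedMeasure D φ] 0 :=
    (withDensity_absolutelyContinuous _ _).ae_le ((ae_restrict_iff' hD.measurableSet).2 hfj)
  exact Lp.ext (((hf j).trans hfj').trans (Lp.coeFn_zero _ _ _).symm)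

/-- `H₁ = L²(D, φ)^{⊕p}`, the domain of `T₁` and `T₂`. -/
abbrev L2Tuple (p : ℕ) (D : Set (Fin n → ℂ)) (φ : (Fin n → ℂ) → ℝ) : Type :=
  PiLp 2 fun _ : Fin p => L2 D φ

/-- `H₃ = L²_{(0,1)}(D, φ)^{⊕p}`. -/
abbrev L2FormTuple (p : ℕ) (D : Set (Fin n → ℂ)) (φ : (Fin n → ℂ) → ℝ) : Type :=
  PiLp 2 fun _ : Fin p => L2Form D φ

/-- `T₂ h = (∂̄h₁, …, ∂̄h_p)`, defined when all `h_i` are in the domain of `∂̄`. -/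
noncomputable def T₂ (p : ℕ) (D : Set (Fin n → ℂ)) (φ : (Fin n → ℂ) → ℝ) :
    L2Tuple p D φ →ₗ.[ℂ] L2FormTuple p D φ where
  domain :=
    { carrier := {h | ∀ i, h i ∈ (dbar D φ).domain}
      zero_mem' := fun _ => (dbar D φ).domain.zero_mem
      add_mem' := fun h h' i => (dbar D φ).domain.add_mem (h i) (h' i)
      smul_mem' := fun c _ h i => (dbar D φ).domain.smul_mem c (h i) }
  toFun :=
    { toFun := fun h => WithLp.toLp 2 fun i => dbar D φ ⟨h.1 i, h.2 i⟩
      map_add' := fun h h' => by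
        ext i : 1
        exact (dbar D φ).map_add ⟨h.1 i, h.2 i⟩ ⟨h'.1 i, h'.2 i⟩
      map_smul' := fun c h => by
        ext i : 1
        exact (dbar D φ).map_smul c ⟨h.1 i, h.2 i⟩ }

/-- The function `φ(z) = a‖z‖²` on `ℂⁿ`, with the Euclidean norm. -/
noncomputable def quadraticWeight (n : ℕ) (a : ℝ) (z : Fin n → ℂ) : ℝ :=
  a * ∑ i, ‖z i‖ ^ 2

/-- `T₁ h = ∑ g_i h_i`, a bounded operator `L²(D, φ)^{⊕p} → L²(D, φ)` for bounded `g_i`. -/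
noncomputable def T₁ (D : Set (Fin n → ℂ)) (φ : (Fin n → ℂ) → ℝ) (g : Fin p → (Fin n → ℂ) → ℂ)
    (hg : ∀ i, MemLp (g i) ∞ (weightedMeasure D φ)) : L2Tuple p D φ →L[ℂ] L2 D φ :=
  ∑ i, ((ContinuousLinearMap.mul ℂ ℂ).holderL (weightedMeasure D φ) ∞ 2 2 (hg i).toLp).comp
    (PiLp.proj 2 (fun _ : Fin p => L2 D φ) i)

/-- Bounded holomorphic tuples have essentially bounded components. -/
theorem memLp_top_of_bounded {D : Set (Fin n → ℂ)} (hD : IsOpen D) (φ : (Fin n → ℂ) → ℝ)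
    {g : Fin p → (Fin n → ℂ) → ℂ} (hg : ∀ i, DifferentiableOn ℂ (g i) D)
    (hb : BddAbove ((fun z => ∑ i, ‖g i z‖ ^ 2) '' D)) (i : Fin p) :
    MemLp (g i) ∞ (weightedMeasure D φ) := by
  obtain ⟨M, hM⟩ := hb
  have hac : weightedMeasure D φ ≪ volume.restrict D := withDensity_absolutelyContinuous _ _
  refine memLp_top_of_bound
    (((hg i).continuousOn.aestronglyMeasurable hD.measurableSet).mono_ac hac) (√M) ?_
  refine hac.ae_le ((ae_restrict_iff' hD.measurableSet).2 (Filter.Eventually.of_forall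
    fun z hz => Real.le_sqrt_of_sq_le ?_))
  exact (Finset.single_le_sum (f := fun i => ‖g i z‖ ^ 2) (fun _ _ => by positivity)
    (Finset.mem_univ i)).trans (hM (Set.mem_image_of_mem _ hz))

end L2Division

open L2Division MeasureTheory

namespace L2Division

open MeasureTheory
open scoped ENNReal ContDiff ComplexOrder Convolution

variable {n p : ℕ}

/-! For `φ = a‖z‖²` the curvature operator is `a` times the identity, so `L²`-optimality solves `∂̄s
= f` with `a‖s‖² ≤ ‖f‖²`: large `a` makes solutions small. The adjoint `T₁*u = (u ḡ₁, …, u ḡ_p)`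
satisfies `‖T₁*u‖² ≥ m‖u‖²` with `m = inf |g|²`. For holomorphic `u` it fails to be holomorphic only
through the derivatives of `g`: `‖∂̄(T₁*u)‖² ≤ M‖u‖²`, where `M` bounds `|∂g|²`.

For the first claim, elements of `(Ker T₂*)ᗮ` are `∂̄`-closed (`isDbarClosed_of_orthogonal`), so `v
= T₂s` with `s` small. By duality `a‖v‖² ≤ ‖T₂*v‖²`, and the cross term `⟨T₂*v, T₁*u⟩ = ⟨v,
∂̄(T₁*u)⟩` is absorbed at the cost of `(M/a)‖u‖²` (`le_norm_add_sq_of_inner_eq`).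

The division claim does not pass through the first, and so needs no density of the domain of `T₂`.
Subtracting from `T₁*u` a small solution of `∂̄s = ∂̄(T₁*u)` leaves a holomorphic tuple; hence the
projection of `T₁*u` to holomorphic tuples still has squared norm at least `(m - M/a)‖u‖²`. This
projection is the adjoint of `T₁` between the spaces of holomorphic elements, and an adjoint bounded
below makes `T₁` onto there (`exists_mem_eq_of_adjoint_bounded_below`). Weyl's lemma for `∂̄` turns
weakly holomorphic classes into holomorphic functions. -/

/-! ### Wirtinger calculus and the weak `∂̄`-equation -/

theorem dzbar_mul {j : Fin n} {F G : (Fin n → ℂ) → ℂ} {z : Fin n → ℂ}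
    (hF : DifferentiableAt ℝ F z) (hG : DifferentiableAt ℝ G z) :
    dzbar j (fun w => F w * G w) z = dzbar j F z * G z + F z * dzbar j G z := by
  simp only [dzbar, fderiv_fun_mul hF hG, add_apply, smul_apply, smul_eq_mul]
  ring

theorem dzbar_star (j : Fin n) (F : (Fin n → ℂ) → ℂ) (z : Fin n → ℂ) :
    dzbar j (fun w => star (F w)) z = star (dz j F z) := by
  have h : fderiv ℝ (fun w => star (F w)) z = (Complex.conjCLE : ℂ →L[ℝ] ℂ).comp (fderiv ℝ F z) :=
    Complex.conjCLE.comp_fderiv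
  simp only [dzbar, dz, h]
  simp

theorem dzbar_eq_zero {j : Fin n} {F : (Fin n → ℂ) → ℂ} {z : Fin n → ℂ}
    (hF : DifferentiableAt ℂ F z) : dzbar j F z = 0 := by
  have h1 : (Pi.single j Complex.I : Fin n → ℂ) = Complex.I • Pi.single j (1 : ℂ) := by
    rw [← Pi.single_smul]; simp
  rw [dzbar, hF.fderiv_restrictScalars ℝ, h1]
  simp only [ContinuousLinearMap.coe_restrictScalars', map_smul, smul_eq_mul, ← mul_assoc,
    Complex.I_mul_I]
  ring

/-- The Cauchy–Riemann equations in each variable say that the real derivative commutes with `i` on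
every coordinate axis, hence is complex linear. -/
theorem differentiableAt_of_dzbar_eq_zero {F : (Fin n → ℂ) → ℂ} {z : Fin n → ℂ}
    (hF : DifferentiableAt ℝ F z) (h : ∀ j, dzbar j F z = 0) : DifferentiableAt ℂ F z := by
  set L := fderiv ℝ F z with hL
  have h1 : ∀ j, L (Pi.single j Complex.I) = Complex.I * L (Pi.single j 1) := by
    intro j
    have h2 := h j
    simp only [dzbar, ← hL, mul_eq_zero, one_div, inv_eq_zero, OfNat.ofNat_ne_zero, false_or] at h2
    linear_combination (-Complex.I) * h2 + L (Pi.single j Complex.I) * Complex.I_mul_I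
  have h2 : ∀ j (c : ℂ), L (Pi.single j c) = c * L (Pi.single j 1) := by
    intro j c
    have : (Pi.single j c : Fin n → ℂ) = c.re • (Pi.single j 1 : Fin n → ℂ)
        + c.im • (Pi.single j Complex.I : Fin n → ℂ) := by
      rw [← Pi.single_smul, ← Pi.single_smul, ← Pi.single_add]
      congr 1
      conv_lhs => rw [← Complex.re_add_im c]
      simp
    rw [this, map_add, map_smul, map_smul, h1]
    conv_rhs => rw [← Complex.re_add_im c]
    simp only [Complex.real_smul]
    ring
  have h3 : ∀ v, L v = ∑ j, v j * L (Pi.single j 1) := by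
    intro v
    conv_lhs => rw [← Finset.univ_sum_single v, map_sum]
    exact Finset.sum_congr rfl fun j _ => h2 j _
  rw [differentiableAt_iff_restrictScalars ℝ hF]
  refine ⟨∑ j, (ContinuousLinearMap.proj (R := ℂ) (φ := fun _ : Fin n => ℂ) j).smulRight
    (L (Pi.single j 1)), ?_⟩
  ext v
  rw [← hL, h3 v]
  simp

theorem dzbar_comm {F : (Fin n → ℂ) → ℂ} (hF : ContDiff ℝ ∞ F) (j k : Fin n) (z : Fin n → ℂ) :
    dzbar j (dzbar k F) z = dzbar k (dzbar j F) z := by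
  have hd : DifferentiableAt ℝ (fderiv ℝ F) z :=
    ((hF.fderiv_right (m := ∞) (by simp)).differentiable (by simp)) z
  have hs : IsSymmSndFDerivAt ℝ F z := hF.contDiffAt.isSymmSndFDerivAt (by
    rw [minSmoothness_of_isRCLikeNormedField]; exact WithTop.coe_le_coe.2 (le_top : (2 : ℕ∞) ≤ ⊤))
  have h1 : ∀ v w, fderiv ℝ (fun x => fderiv ℝ F x v) z w = fderiv ℝ (fderiv ℝ F) z w v := by
    intro v w
    rw [fderiv_clm_apply hd (by fun_prop)]
    simp
  have h2 : ∀ k w, fderiv ℝ (dzbar k F) z w = (1 / 2 : ℂ) *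
      (fderiv ℝ (fderiv ℝ F) z w (Pi.single k 1)
        + Complex.I * fderiv ℝ (fderiv ℝ F) z w (Pi.single k Complex.I)) := by
    intro k w
    have hv : ∀ v, DifferentiableAt ℝ (fun x => fderiv ℝ F x v) z := fun v => by fun_prop
    unfold dzbar
    rw [fderiv_const_mul (by fun_prop), fderiv_fun_add (hv _) (by fun_prop), fderiv_const_mul (hv _)]
    simp only [smul_apply, add_apply, smul_eq_mul, h1]
  rw [dzbar, dzbar, h2, h2, h2, h2, hs.eq (Pi.single j 1), hs.eq (Pi.single j 1),
    hs.eq (Pi.single j Complex.I), hs.eq (Pi.single j Complex.I)]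
  ring

theorem contDiff_dzbar {F : (Fin n → ℂ) → ℂ} (hF : ContDiff ℝ ∞ F) (j : Fin n) :
    ContDiff ℝ ∞ (dzbar j F) := by
  have h : ContDiff ℝ ∞ (fderiv ℝ F) := hF.fderiv_right (by simp)
  unfold dzbar
  fun_prop

theorem IsTestFunction.dzbar {D : Set (Fin n → ℂ)} {χ : (Fin n → ℂ) → ℂ}
    (h : IsTestFunction D χ) (j : Fin n) : IsTestFunction D (dzbar j χ) := by
  have hs : tsupport (L2Division.dzbar j χ) ⊆ tsupport χ :=
    closure_minimal (support_dzbar j) (isClosed_tsupport _)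
  exact ⟨contDiff_dzbar h.1 j, h.2.1.of_isClosed_subset (isClosed_tsupport _) hs, hs.trans h.2.2⟩

theorem dzbar_comp_sub {η : (Fin n → ℂ) → ℂ} (j : Fin n) (z s : Fin n → ℂ) :
    dzbar j (fun s => η (z - s)) s = -dzbar j η (z - s) := by
  have h : fderiv ℝ (fun s => η (z - s)) s = -fderiv ℝ η (z - s) := by
    have h1 := (ContinuousLinearEquiv.neg ℝ (M := Fin n → ℂ)).comp_right_fderiv
      (f := fun s => η (z + s)) (x := s)
    simp only [fderiv_comp_add_left, ContinuousLinearEquiv.coe_neg] at h1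
    simp only [sub_eq_add_neg]
    refine h1.trans ?_
    ext v
    simp
  simp only [dzbar, h, neg_apply]
  ring

/-- A function smooth on `D` times a test function is a test function. -/
theorem IsTestFunction.mul {D : Set (Fin n → ℂ)} (hD : IsOpen D) {χ G : (Fin n → ℂ) → ℂ}
    (h : IsTestFunction D χ) (hG : ContDiffOn ℝ ∞ G D) : IsTestFunction D fun z => G z * χ z := by
  have hs : tsupport (fun z => G z * χ z) ⊆ tsupport χ :=
    closure_mono (Function.support_mul_subset_right G χ)
  refine ⟨?_, h.2.1.mul_left, hs.trans h.2.2⟩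
  refine contDiff_iff_contDiffAt.2 fun z => ?_
  by_cases hz : z ∈ D
  · exact (hG.contDiffAt (hD.mem_nhds hz)).mul h.1.contDiffAt
  · have hz' : z ∉ tsupport fun z => G z * χ z := fun hh => hz (h.2.2 (hs hh))
    exact contDiffAt_const.congr_of_eventuallyEq (notMem_tsupport_iff_eventuallyEq.1 hz')

/-- This is `∂̄² = 0`, moved to the test function, where it is the symmetry of second derivatives.
-/
theorem IsWeakDbar.isDbarClosed {D : Set (Fin n → ℂ)} {u : (Fin n → ℂ) → ℂ}
    {f : Fin n → (Fin n → ℂ) → ℂ} (h : IsWeakDbar D u f) : IsDbarClosed D f := by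
  refine ⟨h.2.1, fun χ hχ j k => ?_⟩
  rw [← neg_inj, ← h.2.2 _ (hχ.dzbar k) j, ← h.2.2 _ (hχ.dzbar j) k]
  simp only [dzbar_comm hχ.1 j k]

/-- The Leibniz rule for a weakly holomorphic function times a smooth function. -/
theorem IsWeakDbar.mul_contDiffOn {D : Set (Fin n → ℂ)} (hD : IsOpen D) {u G : (Fin n → ℂ) → ℂ}
    (h : IsWeakDbar D u 0) (hG : ContDiffOn ℝ ∞ G D) :
    IsWeakDbar D (fun z => u z * G z) fun j z => u z * dzbar j G z := by
  have hc : ∀ j, ContinuousOn (L2Division.dzbar j G) D := by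
    intro j
    have : ContinuousOn (fderiv ℝ G) D := hG.continuousOn_fderiv_of_isOpen hD (by simp)
    unfold L2Division.dzbar
    fun_prop
  refine ⟨h.1.mul_continuousOn hG.continuousOn hD.isLocallyClosed,
    fun j => h.1.mul_continuousOn (hc j) hD.isLocallyClosed, fun χ hχ j => ?_⟩
  -- The weak equation for `u` is tested against `Gχ`; the Leibniz rule is then applied to smooth
  -- functions only.
  have hGχ := hχ.mul hD hG
  have h0 := h.2.2 _ hGχ j
  simp only [Pi.zero_apply, zero_mul, integral_zero, neg_zero] at h0
  rw [eq_neg_iff_add_eq_zero, ← integral_add, ← h0]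
  · refine setIntegral_congr_fun hD.measurableSet fun z hz => ?_
    have hd : DifferentiableAt ℝ G z :=
      ((hG.contDiffAt (hD.mem_nhds hz)).differentiableAt (by simp))
    simp only
    rw [dzbar_mul hd (hχ.1.contDiffAt.differentiableAt (by simp))]
    ring
  · exact integrable_mul_of_support hχ (h.1.mul_continuousOn hG.continuousOn hD.isLocallyClosed)
      (hχ.continuous_dzbar j) (support_dzbar j)
  · exact integrable_mul_of_support hχ (h.1.mul_continuousOn (hc j) hD.isLocallyClosed)
      hχ.1.continuous subset_closure

theorem integral_dzbar {D : Set (Fin n → ℂ)} {χ : (Fin n → ℂ) → ℂ} (h : IsTestFunction D χ)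
    (j : Fin n) : ∫ z in D, dzbar j χ z = 0 := by
  have h1 : ∀ v, Integrable (fun z => fderiv ℝ χ z v) := by
    intro v
    refine Continuous.integrable_of_hasCompactSupport ?_ ?_
    · exact (h.1.continuous_fderiv (by simp)).clm_apply continuous_const
    · exact h.2.1.fderiv_apply ℝ v
  have h2 : ∀ v, ∫ z, fderiv ℝ χ z v = 0 := by
    intro v
    -- Integration by parts against the constant function `1`.
    have := integral_mul_fderiv_eq_neg_fderiv_mul_of_integrable (μ := volume) (𝕜 := ℂ)
      (f := fun _ : Fin n → ℂ => (1 : ℂ)) (g := χ) (v := v) (by simp) (by simpa using h1 v)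
      (by simpa using h.1.continuous.integrable_of_hasCompactSupport h.2.1)
      (fun _ _ => by fun_prop) (fun x _ => h.1.contDiffAt.differentiableAt (by simp))
    simpa using this
  rw [setIntegral_eq_integral_of_forall_compl_eq_zero
    fun z hz => Function.notMem_support.1 fun hh => hz (h.2.2 (support_dzbar j hh))]
  unfold dzbar
  rw [integral_const_mul, integral_add (h1 _) ((h1 _).const_mul _), integral_const_mul, h2, h2]
  simp

/-! ### Curvature of the weight `a‖z‖²` -/

theorem dz_apply_eq (j k : Fin n) (z : Fin n → ℂ) :
    dz j (fun w => w k) z = if k = j then 1 else 0 := by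
  have : fderiv ℝ (fun w : Fin n → ℂ => w k) z
      = ContinuousLinearMap.proj (R := ℝ) (φ := fun _ : Fin n => ℂ) k :=
    (ContinuousLinearMap.proj (R := ℝ) (φ := fun _ : Fin n => ℂ) k).fderiv
  rw [dz, this]
  simp only [ContinuousLinearMap.proj_apply, Pi.single_apply]
  split_ifs <;> simp
  norm_num

theorem contDiff_quadraticWeight (a : ℝ) : ContDiff ℝ ∞ (quadraticWeight n a) := by
  unfold quadraticWeight
  refine contDiff_const.mul (ContDiff.sum fun i _ => ?_)
  exact (contDiff_apply ℝ ℂ i).norm_sq ℝ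

theorem dzbar_quadraticWeight (a : ℝ) (k : Fin n) (z : Fin n → ℂ) :
    dzbar k (fun w => (quadraticWeight n a w : ℂ)) z = a * z k := by
  have hw : (fun w => (quadraticWeight n a w : ℂ))
      = fun w : Fin n → ℂ => (a : ℂ) * ∑ i, w i * star (w i) := by
    ext w
    simp [quadraticWeight, Complex.mul_conj, Complex.normSq_eq_norm_sq]
  have hd : ∀ i, DifferentiableAt ℝ (fun w : Fin n → ℂ => w i) z := fun i => by fun_prop
  have hd' : ∀ i, DifferentiableAt ℝ (fun w : Fin n → ℂ => star (w i)) z := fun i =>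
    Complex.conjCLE.differentiableAt.comp z (hd i)
  have hdd : ∀ i, DifferentiableAt ℝ (fun w : Fin n → ℂ => w i * star (w i)) z :=
    fun i => (hd i).mul (hd' i)
  have h1 : dzbar k (fun w : Fin n → ℂ => ∑ i, w i * star (w i)) z
      = ∑ i, dzbar k (fun w : Fin n → ℂ => w i * star (w i)) z := by
    simp only [dzbar]
    rw [fderiv_fun_sum fun i _ => hdd i]
    simp only [sum_apply, Finset.mul_sum, ← Finset.sum_add_distrib]
  rw [hw, dzbar_mul (by fun_prop) (DifferentiableAt.fun_sum fun i _ => hdd i), h1]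
  have h2 : ∀ i, dzbar k (fun w : Fin n → ℂ => w i * star (w i)) z = if i = k then z i else 0 := by
    intro i
    rw [dzbar_mul (hd i) (hd' i), dzbar_star, dz_apply_eq, dzbar_eq_zero (by fun_prop)]
    split_ifs <;> simp
  simp only [h2, Finset.sum_ite_eq', Finset.mem_univ, if_true]
  rw [dzbar_eq_zero (by fun_prop)]
  simp

theorem curvatureMatrix_quadraticWeight (a : ℝ) (z : Fin n → ℂ) :
    curvatureMatrix (quadraticWeight n a) z = (a : ℂ) • (1 : Matrix (Fin n) (Fin n) ℂ) := by
  ext k j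
  have h1 : dzbar k (fun w => (quadraticWeight n a w : ℂ)) = fun w : Fin n → ℂ => (a : ℂ) * w k := by
    ext w
    exact dzbar_quadraticWeight a k w
  have h2 : dz j (fun w : Fin n → ℂ => (a : ℂ) * w k) z = a * dz j (fun w => w k) z := by
    unfold dz
    rw [fderiv_const_mul (by fun_prop)]
    simp only [smul_apply, smul_eq_mul]
    ring
  simp only [curvatureMatrix, Matrix.of_apply, h1, h2, dz_apply_eq]
  simp [Matrix.one_apply]

theorem isSmoothStrictlyPsh_quadraticWeight {a : ℝ} (ha : 0 < a) :
    IsSmoothStrictlyPsh (quadraticWeight n a) := by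
  refine ⟨contDiff_quadraticWeight a, fun z => ?_⟩
  rw [curvatureMatrix_quadraticWeight]
  exact Matrix.PosDef.one.smul (by exact_mod_cast ha)

theorem curvatureInvForm_quadraticWeight {a : ℝ} (ha : 0 < a) (f : Fin n → (Fin n → ℂ) → ℂ)
    (z : Fin n → ℂ) :
    curvatureInvForm (quadraticWeight n a) f z = a⁻¹ * ∑ k, ‖f k z‖ ^ 2 := by
  have h : ((a : ℂ) • (1 : Matrix (Fin n) (Fin n) ℂ))⁻¹ = (a : ℂ)⁻¹ • 1 := by
    have ha' : (a : ℂ) ≠ 0 := by exact_mod_cast ha.ne'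
    refine Matrix.inv_eq_right_inv ?_
    rw [smul_mul_smul_comm, mul_inv_cancel₀ ha', one_smul, one_mul]
  rw [curvatureInvForm, curvatureMatrix_quadraticWeight, h, Finset.mul_sum, Complex.re_sum]
  refine Finset.sum_congr rfl fun k _ => ?_
  rw [Matrix.smul_mulVec, Matrix.one_mulVec, Pi.smul_apply, smul_eq_mul, mul_assoc,
    Complex.star_def, Complex.mul_conj, Complex.normSq_eq_norm_sq, ← Complex.ofReal_inv,
    ← Complex.ofReal_mul, Complex.ofReal_re]

/-! ### Mean value property and Weyl's lemma for `∂̄` -/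

/-- There are mollifiers on `ℂⁿ` that are invariant under the scalar action of the circle. -/
theorem exists_circle_invariant_mollifier (n : ℕ) {ε : ℝ} (hε : 0 < ε) :
    ∃ ρ : (Fin n → ℂ) → ℝ, ContDiff ℝ ∞ ρ ∧ tsupport ρ ⊆ Metric.closedBall 0 ε ∧
      (∀ c : ℂ, ‖c‖ = 1 → ∀ w, ρ (c • w) = ρ w) ∧ ∫ w, ρ w = 1 := by
  -- A bump evaluated at the squared Euclidean norm is smooth and circle invariant. The radii are on
  -- the scale of squares; the sup norm is at most the Euclidean one, so the support lies in the
  -- sup-norm ball of radius `ε`.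
  let b : ContDiffBump (0 : ℝ) := ⟨ε ^ 2 / 4, ε ^ 2 / 2, by positivity, by nlinarith [sq_pos_of_pos hε]⟩
  set ρ : (Fin n → ℂ) → ℝ := fun w => b (∑ i, ‖w i‖ ^ 2) with hρ
  have hc : ContDiff ℝ ∞ ρ :=
    b.contDiff.comp (ContDiff.sum fun i _ => (contDiff_apply ℝ ℂ i).norm_sq ℝ)
  have hs : tsupport ρ ⊆ Metric.closedBall 0 ε := by
    refine closure_minimal (fun w hw => ?_) Metric.isClosed_closedBall
    have h1 : ∑ i, ‖w i‖ ^ 2 ∈ Metric.ball (0 : ℝ) (ε ^ 2 / 2) := by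
      have : ∑ i, ‖w i‖ ^ 2 ∈ Function.support b := hw
      rwa [b.support_eq] at this
    rw [mem_ball_zero_iff, Real.norm_eq_abs] at h1
    rw [mem_closedBall_zero_iff, pi_norm_le_iff_of_nonneg hε.le]
    intro i
    have h2 : ‖w i‖ ^ 2 ≤ ∑ i, ‖w i‖ ^ 2 :=
      Finset.single_le_sum (f := fun i => ‖w i‖ ^ 2) (fun _ _ => by positivity) (Finset.mem_univ i)
    have h3 := le_abs_self (∑ i, ‖w i‖ ^ 2)
    exact le_of_sq_le_sq (by nlinarith [sq_pos_of_pos hε]) hε.le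
  have hcs : HasCompactSupport ρ :=
    (isCompact_closedBall 0 ε).of_isClosed_subset (isClosed_tsupport _) hs
  have hpos : 0 < ∫ w, ρ w := by
    refine hc.continuous.integral_pos_of_hasCompactSupport_nonneg_nonzero hcs (fun w => b.nonneg)
      (x := 0) ?_
    have : ρ 0 = 1 := by
      simp only [hρ, Pi.zero_apply, norm_zero]
      exact b.one_of_mem_closedBall (by simp [b.rIn_pos.le])
    simp [this]
  refine ⟨fun w => (∫ w, ρ w)⁻¹ * ρ w, contDiff_const.mul hc,
    (closure_mono (Function.support_mul_subset_right _ ρ)).trans hs, fun c hc w => ?_, ?_⟩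
  · simp [hρ, hc]
  · rw [integral_const_mul, inv_mul_cancel₀ hpos.ne']

/-- Multiplication by `c` is a product of plane rotations, each of which preserves area. -/
theorem integral_comp_circle_smul {F : Type*} [NormedAddCommGroup F] [NormedSpace ℝ F]
    (G : (Fin n → ℂ) → F) {c : ℂ} (hc : ‖c‖ = 1) : ∫ t, G (c • t) = ∫ t, G t := by
  have hc0 : c ≠ 0 := fun h => by simp [h] at hc
  let c' : Circle := ⟨c, by simp [Submonoid.unitSphere, hc]⟩
  have h1 : MeasurePreserving (fun t : Fin n → ℂ => fun i => rotation c' (t i)) :=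
    volume_preserving_pi fun _ => (rotation c').measurePreserving
  have h2 : (fun t : Fin n → ℂ => fun i => rotation c' (t i)) = fun t => c • t := by
    ext t i
    exact rotation_apply c' (t i)
  rw [h2] at h1
  exact h1.integral_comp (Homeomorph.smulOfNeZero c hc0).measurableEmbedding G

/-- The mean value property on `ℂⁿ`, for circle invariant mollifiers. -/
theorem integral_mollifier_smul {U : Set (Fin n → ℂ)} (hU : IsOpen U) {F : (Fin n → ℂ) → ℂ}
    (hF : DifferentiableOn ℂ F U) {z : Fin n → ℂ} {ε : ℝ} (hz : Metric.closedBall z ε ⊆ U)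
    {ρ : (Fin n → ℂ) → ℝ} (hρ : Continuous ρ) (hs : tsupport ρ ⊆ Metric.closedBall 0 ε)
    (hinv : ∀ c : ℂ, ‖c‖ = 1 → ∀ w, ρ (c • w) = ρ w) (h1 : ∫ w, ρ w = 1) :
    ∫ t, ρ t • F (z - t) = F z := by
  have hmem : ∀ t ∈ Metric.closedBall (0 : Fin n → ℂ) ε, z - t ∈ U := fun t ht =>
    hz (by simpa [dist_eq_norm] using ht)
  set G : (Fin n → ℂ) → ℂ := fun t => ρ t • F (z - t) with hG
  have hG0 : ∀ t ∉ Metric.closedBall (0 : Fin n → ℂ) ε, G t = 0 := fun t ht => by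
    simp [hG, image_eq_zero_of_notMem_tsupport fun h => ht (hs h)]
  have hGc : Continuous G := by
    rw [continuous_iff_continuousAt]
    intro t
    by_cases ht : t ∈ tsupport ρ
    · have : ContinuousAt F (z - t) :=
        (hF.differentiableAt (hU.mem_nhds (hmem t (hs ht)))).continuousAt
      exact hρ.continuousAt.smul (this.comp (f := fun t => z - t) (by fun_prop))
    · have h0 : G =ᶠ[nhds t] fun _ => 0 :=
        (notMem_tsupport_iff_eventuallyEq.1 ht).mono fun s hs => by simp [hG, hs]
      exact continuousAt_const.congr h0.symm
  have hcm : ∀ θ : ℝ, ‖circleMap 0 1 θ‖ = 1 := fun θ => by simp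
  -- Invariance makes `ρ` constant along the circle through `t`, and the one-variable mean value
  -- property applies to `ζ ↦ F (z - ζt)` on the unit disc.
  have hmean : ∀ t, ∫ θ in Set.Ioc 0 (2 * Real.pi), G (circleMap 0 1 θ • t)
      = ρ t • ((2 * Real.pi) • F z) := by
    intro t
    simp only [hG, hinv _ (hcm _)]
    rw [integral_smul]
    by_cases ht : t ∈ Metric.closedBall (0 : Fin n → ℂ) ε
    · congr 1
      have hd : DiffContOnCl ℂ (fun ζ : ℂ => F (z - ζ • t)) (Metric.ball 0 |(1 : ℝ)|) := by
        refine DifferentiableOn.diffContOnCl fun ζ hζ => ?_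
        rw [abs_one, closure_ball _ one_ne_zero, mem_closedBall_zero_iff] at hζ
        have hm : z - ζ • t ∈ U := hmem _ (by
          rw [mem_closedBall_zero_iff] at ht ⊢
          rw [norm_smul]
          nlinarith [norm_nonneg t])
        have := hF.differentiableAt (hU.mem_nhds hm)
        exact (this.comp (f := fun ζ : ℂ => z - ζ • t) ζ (by fun_prop)).differentiableWithinAt
      have hca := hd.circleAverage
      rw [Real.circleAverage, intervalIntegral.integral_of_le (by positivity)] at hca
      rw [zero_smul, sub_zero] at hca
      rw [← hca, smul_inv_smul₀ (by positivity)]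
    · simp [image_eq_zero_of_notMem_tsupport fun h => ht (hs h)]
  -- Integrating over the angle first gives `2π F(z)`; integrating over `t` first gives `2π ∫ G`, by
  -- rotation invariance of the measure.
  have hswap := integral_integral_swap (μ := volume.restrict (Set.Ioc 0 (2 * Real.pi)))
    (ν := (volume : Measure (Fin n → ℂ))) (f := fun θ t => G (circleMap 0 1 θ • t)) (by
      have hcont : Continuous (Function.uncurry fun (θ : ℝ) (t : Fin n → ℂ) =>
          G (circleMap 0 1 θ • t)) := by
        refine hGc.comp ?_
        have := continuous_circleMap 0 1
        fun_prop
      have hi := hcont.continuousOn.integrableOn_compact (μ := (volume : Measure ℝ).prod volume)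
        ((isCompact_Icc (a := (0 : ℝ)) (b := 2 * Real.pi)).prod
          (isCompact_closedBall (0 : Fin n → ℂ) ε))
      have hi2 := hi.of_forall_sdiff_eq_zero (t := Set.Icc 0 (2 * Real.pi) ×ˢ Set.univ)
        (measurableSet_Icc.prod MeasurableSet.univ) (by
          rintro ⟨θ, t⟩ ⟨⟨h1, -⟩, h2⟩
          refine hG0 _ fun h3 => h2 ⟨h1, ?_⟩
          simpa [norm_smul] using h3)
      have hi3 := hi2.mono_set (Set.prod_mono_left (t := Set.univ) Set.Ioc_subset_Icc_self)
      rwa [IntegrableOn, ← Measure.prod_restrict, Measure.restrict_univ] at hi3)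
  simp only [hmean] at hswap
  simp only [integral_comp_circle_smul _ (hcm _)] at hswap
  rw [integral_const, integral_smul_const, h1, one_smul] at hswap
  have h2 : ((volume.restrict (Set.Ioc 0 (2 * Real.pi))).real Set.univ) = 2 * Real.pi := by
    simp [measureReal_def, Real.pi_pos.le]
  rw [h2] at hswap
  exact smul_right_injective ℂ (show (2 * Real.pi : ℝ) ≠ 0 by positivity) hswap

/-- Holomorphic functions of several variables are smooth. -/
theorem contDiffOn_real_of_differentiableOn {D : Set (Fin n → ℂ)} (hD : IsOpen D)
    {F : (Fin n → ℂ) → ℂ} (hF : DifferentiableOn ℂ F D) : ContDiffOn ℝ ∞ F D := by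
  intro z₀ hz₀
  obtain ⟨R, hR, hRD⟩ := Metric.nhds_basis_closedBall.mem_iff.1 (hD.mem_nhds hz₀)
  obtain ⟨ρ, hρ, hs, hinv, h1⟩ := exists_circle_invariant_mollifier n (half_pos hR)
  have hcs : HasCompactSupport ρ :=
    (isCompact_closedBall 0 _).of_isClosed_subset (isClosed_tsupport _) hs
  -- Near `z₀` the mean value property identifies `F` with its convolution with `ρ`, which is
  -- smooth. The cutoff makes the convolution globally defined and is invisible for `z` within `R/2`
  -- of `z₀`.
  have hint : Integrable ((Metric.closedBall z₀ R).indicator F) :=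
    (integrable_indicator_iff Metric.isClosed_closedBall.measurableSet).2
      ((hF.continuousOn.mono hRD).integrableOn_compact (isCompact_closedBall _ _))
  have hsm : ContDiff ℝ ∞
      (ρ ⋆[ContinuousLinearMap.lsmul ℝ ℝ, volume] (Metric.closedBall z₀ R).indicator F) :=
    hcs.contDiff_convolution_left _ hρ hint.locallyIntegrable
  refine (hsm.contDiffAt.congr_of_eventuallyEq ?_).contDiffWithinAt
  filter_upwards [Metric.ball_mem_nhds z₀ (half_pos hR)] with z hz
  rw [Metric.mem_ball] at hz
  have hsub : Metric.closedBall z (R / 2) ⊆ Metric.closedBall z₀ R :=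
    Metric.closedBall_subset_closedBall' (by linarith)
  rw [← integral_mollifier_smul hD hF (hsub.trans hRD) hρ.continuous hs hinv h1, convolution_def]
  refine integral_congr_ae (Filter.Eventually.of_forall fun t => ?_)
  by_cases ht : t ∈ tsupport ρ
  · have : z - t ∈ Metric.closedBall z₀ R := hsub (by simpa [dist_eq_norm] using hs ht)
    simp [Set.indicator_of_mem this]
  · simp [image_eq_zero_of_notMem_tsupport ht]

theorem isWeakDbar_zero_of_differentiableOn {D : Set (Fin n → ℂ)} (hD : IsOpen D)
    {F : (Fin n → ℂ) → ℂ} (hF : DifferentiableOn ℂ F D) : IsWeakDbar D F 0 := by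
  have hs := contDiffOn_real_of_differentiableOn hD hF
  refine ⟨hF.continuousOn.locallyIntegrableOn hD.measurableSet,
    fun j => locallyIntegrableOn_zero, fun χ hχ j => ?_⟩
  have : ∫ z in D, dzbar j (fun z => F z * χ z) z = ∫ z in D, F z * dzbar j χ z := by
    refine setIntegral_congr_fun hD.measurableSet fun z hz => ?_
    have hd := hF.differentiableAt (hD.mem_nhds hz)
    rw [dzbar_mul (hd.restrictScalars ℝ) (hχ.1.contDiffAt.differentiableAt (by simp)),
      dzbar_eq_zero hd, zero_mul, zero_add]
  rw [← this, integral_dzbar (hχ.mul hD hs)]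
  simp

/-- Associativity and commutativity of convolution. In Weyl's lemma it interchanges a fixed
mollifier with one that shrinks. -/
theorem convolution_left_comm {ρ η : (Fin n → ℂ) → ℝ} {h : (Fin n → ℂ) → ℂ}
    (hρ : Continuous ρ) (hρs : HasCompactSupport ρ) (hη : Continuous η)
    (hηs : HasCompactSupport η) (hh : Integrable h) :
    ρ ⋆[ContinuousLinearMap.lsmul ℝ ℝ, volume] (η ⋆[ContinuousLinearMap.lsmul ℝ ℝ, volume] h)
      = η ⋆[ContinuousLinearMap.lsmul ℝ ℝ, volume]
        (ρ ⋆[ContinuousLinearMap.lsmul ℝ ℝ, volume] h) := by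
  have key : ∀ {ρ η : (Fin n → ℂ) → ℝ}, Continuous ρ → HasCompactSupport ρ → Continuous η →
      HasCompactSupport η → ∀ x,
      ((ρ ⋆[ContinuousLinearMap.mul ℝ ℝ, volume] η)
        ⋆[ContinuousLinearMap.lsmul ℝ ℝ, volume] h) x
      = (ρ ⋆[ContinuousLinearMap.lsmul ℝ ℝ, volume]
        (η ⋆[ContinuousLinearMap.lsmul ℝ ℝ, volume] h)) x := by
    intro ρ η hρ hρs hη hηs x
    refine convolution_assoc _ _ _ _ (fun x y z => by simp [mul_assoc]) hρ.aestronglyMeasurable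
      hη.aestronglyMeasurable hh.aestronglyMeasurable
      (Filter.Eventually.of_forall fun y => ?_) (Filter.Eventually.of_forall fun y => ?_) ?_
    · exact hρs.convolutionExists_left _ hρ hη.locallyIntegrable y
    · exact hηs.norm.convolutionExists_left _ hη.norm hh.norm.locallyIntegrable y
    · exact hρs.norm.convolutionExists_left _ hρ.norm
        (hηs.norm.continuous_convolution_left _ hη.norm
          hh.norm.locallyIntegrable).locallyIntegrable x
  ext x
  rw [← key hρ hρs hη hηs, ← key hη hηs hρ hρs]
  congr 1
  rw [← convolution_flip]
  congr 1
  ext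
  simp

/-- Mollifying a weakly holomorphic function gives a holomorphic function. -/
theorem IsWeakDbar.differentiableAt_convolution {D : Set (Fin n → ℂ)} {h : (Fin n → ℂ) → ℂ}
    (hh : IsWeakDbar D h 0) {z₀ : Fin n → ℂ} {R : ℝ} (hK : Metric.closedBall z₀ R ⊆ D)
    {η : (Fin n → ℂ) → ℝ} (hη : ContDiff ℝ ∞ η) {r : ℝ} (hs : tsupport η ⊆ Metric.closedBall 0 r)
    {z : Fin n → ℂ} (hz : dist z z₀ + r ≤ R) :
    DifferentiableAt ℂ (η ⋆[ContinuousLinearMap.lsmul ℝ ℝ, volume]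
      (Metric.closedBall z₀ R).indicator h) z := by
  set K := Metric.closedBall z₀ R
  have hKm : MeasurableSet K := Metric.isClosed_closedBall.measurableSet
  set h1 := K.indicator h with hh1
  have hint : Integrable h1 := (integrable_indicator_iff hKm).2
    (hh.1.integrableOn_compact_subset hK (isCompact_closedBall _ _))
  have hcs : HasCompactSupport η :=
    (isCompact_closedBall 0 _).of_isClosed_subset (isClosed_tsupport _) hs
  have hfd := hcs.hasFDerivAt_convolution_left (ContinuousLinearMap.lsmul ℝ ℝ (E := ℂ))
    (hη.of_le (by simp)) hint.locallyIntegrable z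
  refine differentiableAt_of_dzbar_eq_zero hfd.differentiableAt fun j => ?_
  have hex := (hcs.fderiv ℝ).convolutionExists_left
    ((ContinuousLinearMap.lsmul ℝ ℝ (E := ℂ)).precompL (Fin n → ℂ))
    (hη.continuous_fderiv (by simp)) hint.locallyIntegrable z
  have hap : ∀ v, fderiv ℝ (η ⋆[ContinuousLinearMap.lsmul ℝ ℝ, volume] h1) z v
      = ∫ t, fderiv ℝ η t v • h1 (z - t) := by
    intro v
    rw [hfd.fderiv, convolution_def, ContinuousLinearMap.integral_apply hex]
    rfl
  have hiv : ∀ v, Integrable fun t => fderiv ℝ η t v • h1 (z - t) := fun v =>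
    hex.integrable.apply_continuousLinearMap v
  set ηc : (Fin n → ℂ) → ℂ := fun t => (η t : ℂ) with hηc
  have hηcd : ContDiff ℝ ∞ ηc := Complex.ofRealCLM.contDiff.comp hη
  have hfc : ∀ t v, fderiv ℝ ηc t v = (fderiv ℝ η t v : ℂ) := by
    intro t v
    have := (Complex.ofRealCLM.hasFDerivAt.comp t
      (hη.contDiffAt.differentiableAt (by simp)).hasFDerivAt).fderiv
    rw [show ηc = Complex.ofRealCLM ∘ η from rfl, this]
    rfl
  have h2 : dzbar j (η ⋆[ContinuousLinearMap.lsmul ℝ ℝ, volume] h1) z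
      = ∫ t, dzbar j ηc t * h1 (z - t) := by
    rw [dzbar, hap, hap, ← integral_const_mul, ← integral_add (hiv _) ((hiv _).const_mul _),
      ← integral_const_mul]
    refine integral_congr_ae (Filter.Eventually.of_forall fun t => ?_)
    simp only [dzbar, hfc, Complex.real_smul]
    ring
  -- The derivative of the convolution falls on `η`; the bound `dist z z₀ + r ≤ R` makes the
  -- translated reflection of `η` a test function for the weak equation.
  have h3 : IsTestFunction D fun s => ηc (z - s) := by
    have hsub : tsupport (fun s => ηc (z - s)) ⊆ K := by
      refine closure_minimal (fun s hs' => ?_) Metric.isClosed_closedBall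
      have h4 : z - s ∈ tsupport η := subset_tsupport _ (by simpa [hηc] using hs')
      have h5 := hs h4
      rw [mem_closedBall_zero_iff, ← dist_eq_norm, dist_comm] at h5
      exact Metric.mem_closedBall.2 ((dist_triangle _ _ _).trans (by linarith))
    exact ⟨hηcd.comp (contDiff_const.sub contDiff_id),
      (isCompact_closedBall z₀ R).of_isClosed_subset (isClosed_tsupport _) hsub, hsub.trans hK⟩
  have h4 := hh.2.2 _ h3 j
  simp only [dzbar_comp_sub, Pi.zero_apply, zero_mul, integral_zero, neg_zero, mul_neg,
    integral_neg, neg_eq_zero] at h4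
  have hsuppK : ∀ s ∉ K, dzbar j ηc (z - s) = 0 := by
    intro s hs'
    have : z - s ∉ tsupport ηc := fun h5 => by
      have h6 : z - s ∈ tsupport η :=
        closure_mono (fun t ht => by simpa [hηc] using ht) h5
      have h5 := hs h6
      rw [mem_closedBall_zero_iff, ← dist_eq_norm, dist_comm] at h5
      exact hs' (Metric.mem_closedBall.2 ((dist_triangle _ _ _).trans (by linarith)))
    exact Function.notMem_support.1 fun h => this (support_dzbar j h)
  rw [h2, ← integral_sub_left_eq_self _ volume z, ← h4,
    setIntegral_eq_integral_of_forall_compl_eq_zero]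
  · refine integral_congr_ae (Filter.Eventually.of_forall fun s => ?_)
    by_cases hs' : s ∈ K
    · simp [hh1, Set.indicator_of_mem hs', mul_comm]
    · simp [hsuppK s hs']
  · intro s hs'
    rw [hsuppK s fun h => hs' (hK h), mul_zero]

/-- The function `H` is `ρ ⋆ h` for a fixed circle-invariant `ρ`. For an approximate identity `b k`,
the functions `b k ⋆ h` are holomorphic, so the mean value property gives `b k ⋆ (ρ ⋆ h) = ρ ⋆ (b k
⋆ h) = b k ⋆ h` near `z₀`. The left side tends to `ρ ⋆ h`, the right side to `h` almost everywhere.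
-/
theorem IsWeakDbar.exists_differentiableOn_ball {D : Set (Fin n → ℂ)} (hD : IsOpen D)
    {h : (Fin n → ℂ) → ℂ} (hh : IsWeakDbar D h 0) {z₀ : Fin n → ℂ} (hz₀ : z₀ ∈ D) :
    ∃ ε > 0, ∃ H : (Fin n → ℂ) → ℂ, Metric.ball z₀ ε ⊆ D ∧
      DifferentiableOn ℂ H (Metric.ball z₀ ε) ∧
      h =ᵐ[volume.restrict (Metric.ball z₀ ε)] H := by
  obtain ⟨R, hR, hK⟩ := Metric.nhds_basis_closedBall.mem_iff.1 (hD.mem_nhds hz₀)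
  -- Both mollifiers have radius at most `ε`: `b k ⋆ h` is holomorphic on the ball of radius `3ε`,
  -- which contains the `ε`-ball around each point of the ball of radius `ε`.
  obtain ⟨ε, hε, hεR⟩ : ∃ ε > 0, R = 4 * ε := ⟨R / 4, by positivity, by ring⟩
  obtain ⟨ρ, hρ, hs, hinv, h1⟩ := exists_circle_invariant_mollifier n hε
  have hcs : HasCompactSupport ρ :=
    (isCompact_closedBall 0 _).of_isClosed_subset (isClosed_tsupport _) hs
  set h₁ := (Metric.closedBall z₀ R).indicator h
  have hint : Integrable h₁ :=
    (integrable_indicator_iff Metric.isClosed_closedBall.measurableSet).2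
    (hh.1.integrableOn_compact_subset hK (isCompact_closedBall _ _))
  refine ⟨ε, hε, ρ ⋆[ContinuousLinearMap.lsmul ℝ ℝ, volume] h₁,
    (Metric.ball_subset_closedBall.trans
      (Metric.closedBall_subset_closedBall (by linarith))).trans hK, fun z hz => ?_, ?_⟩
  · rw [Metric.mem_ball] at hz
    exact (hh.differentiableAt_convolution hK hρ hs (by linarith)).differentiableWithinAt
  let b : ℕ → ContDiffBump (0 : Fin n → ℂ) := fun k =>
    ⟨ε / (2 * (k + 1)), ε / (k + 1), by positivity, by
      rw [div_lt_div_iff_of_pos_left hε (by positivity) (by positivity)]; linarith⟩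
  have hb : Filter.Tendsto (fun k => (b k).rOut) Filter.atTop (nhds 0) := by
    have := (tendsto_one_div_add_atTop_nhds_zero_nat (𝕜 := ℝ)).const_mul ε
    simpa [b, div_eq_mul_inv] using this
  have hae := ContDiffBump.ae_convolution_tendsto_right_of_locallyIntegrable (μ := volume)
    (φ := b) (K := 2) hb (Filter.Eventually.of_forall fun k => le_of_eq (by
      simp only [b]; field_simp)) hint.locallyIntegrable
  rw [Filter.EventuallyEq, ae_restrict_iff' Metric.isOpen_ball.measurableSet]
  filter_upwards [hae] with z hz hzB
  rw [Metric.mem_ball] at hzB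
  have hzh : h₁ z = h z := Set.indicator_of_mem (Metric.mem_closedBall.2 (by linarith)) _
  rw [← hzh]
  have hcont : Continuous (ρ ⋆[ContinuousLinearMap.lsmul ℝ ℝ, volume] h₁) :=
    hcs.continuous_convolution_left _ hρ.continuous hint.locallyIntegrable
  have hlim := ContDiffBump.convolution_tendsto_right_of_continuous (μ := volume) (φ := b) hb
    hcont z
  refine tendsto_nhds_unique hz (hlim.congr fun k => ?_)
  have hbk : ContDiff ℝ ∞ ((b k).normed volume) := (b k).contDiff_normed
  have hbs : tsupport ((b k).normed volume) ⊆ Metric.closedBall 0 ε := by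
    rw [(b k).tsupport_normed_eq]
    refine Metric.closedBall_subset_closedBall ?_
    simp only [b]
    exact div_le_self hε.le (by linarith [(k.cast_nonneg : (0 : ℝ) ≤ k)])
  rw [← convolution_left_comm hρ.continuous hcs hbk.continuous (b k).hasCompactSupport_normed
    hint]
  have hd : DifferentiableOn ℂ ((b k).normed volume
      ⋆[ContinuousLinearMap.lsmul ℝ ℝ, volume] h₁) (Metric.ball z₀ (3 * ε)) := fun w hw =>
    (hh.differentiableAt_convolution hK hbk hbs (by
      rw [Metric.mem_ball] at hw; linarith)).differentiableWithinAt
  exact integral_mollifier_smul Metric.isOpen_ball hd (fun w hw => by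
    rw [Metric.mem_closedBall] at hw
    exact Metric.mem_ball.2 ((dist_triangle _ z _).trans_lt (by linarith))) hρ.continuous hs hinv h1

/-- Weyl's lemma for `∂̄`: weakly holomorphic functions are holomorphic. -/
theorem IsWeakDbar.exists_differentiableOn {D : Set (Fin n → ℂ)} (hD : IsOpen D)
    {h : (Fin n → ℂ) → ℂ} (hh : IsWeakDbar D h 0) :
    ∃ H : (Fin n → ℂ) → ℂ, DifferentiableOn ℂ H D ∧ h =ᵐ[volume.restrict D] H := by
  have hloc := fun z₀ hz₀ => hh.exists_differentiableOn_ball (z₀ := z₀) hD hz₀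
  choose! ε hε H hBD hH hHae using hloc
  -- Local holomorphic representatives agree almost everywhere on overlaps, hence everywhere by
  -- continuity, so the diagonal choice `H z z` glues them.
  have hself : ∀ z₀ ∈ D, Set.EqOn (fun z => H z z) (H z₀) (Metric.ball z₀ (ε z₀)) := by
    intro z₀ hz₀ z hz
    have hzD := hBD z₀ hz₀ hz
    have hU : IsOpen (Metric.ball z₀ (ε z₀) ∩ Metric.ball z (ε z)) :=
      Metric.isOpen_ball.inter Metric.isOpen_ball
    have h1 := (hHae z hzD).filter_mono
      (ae_mono (Measure.restrict_mono (Set.inter_subset_right (s := Metric.ball z₀ (ε z₀))) le_rfl))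
    have h2 := (hHae z₀ hz₀).filter_mono
      (ae_mono (Measure.restrict_mono (Set.inter_subset_left (t := Metric.ball z (ε z))) le_rfl))
    exact Measure.eqOn_open_of_ae_eq (h1.symm.trans h2) hU ((hH z hzD).continuousOn.mono Set.inter_subset_right)
      ((hH z₀ hz₀).continuousOn.mono Set.inter_subset_left)
      ⟨hz, Metric.mem_ball_self (hε z hzD)⟩
  refine ⟨fun z => H z z, fun z₀ hz₀ => ?_, ?_⟩
  · have hnhds := Metric.ball_mem_nhds z₀ (hε z₀ hz₀)
    exact (((hH z₀ hz₀).differentiableAt hnhds).congr_of_eventuallyEq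
      ((hself z₀ hz₀).eventuallyEq_of_mem hnhds)).differentiableWithinAt
  · rw [Filter.EventuallyEq, ae_restrict_iff' hD.measurableSet, ae_iff]
    refine measure_null_of_locally_null _ fun z₀ hz₀ => ?_
    simp only [Set.mem_ofPred_eq, Classical.not_imp] at hz₀
    refine ⟨_, Filter.inter_mem self_mem_nhdsWithin
      (mem_nhdsWithin_of_mem_nhds (Metric.ball_mem_nhds z₀ (hε z₀ hz₀.1))), ?_⟩
    have h1 := hHae z₀ hz₀.1
    rw [Filter.EventuallyEq, ae_restrict_iff' Metric.isOpen_ball.measurableSet, ae_iff] at h1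
    refine measure_mono_null (fun z hz => ?_) h1
    obtain ⟨hz1, hz2⟩ := hz
    simp only [Set.mem_ofPred_eq, Classical.not_imp] at hz1 ⊢
    exact ⟨hz2, by rw [← hself z₀ hz₀.1 hz2]; exact hz1.2⟩

/-! ### Weighted `L²` spaces -/

/-- `θ` is measurable and bounded above on the compact subsets of the open set `D`. -/
structure IsWeight (D : Set (Fin n → ℂ)) (θ : (Fin n → ℂ) → ℝ) : Prop where
  isOpen : IsOpen D
  aemeasurable : AEMeasurable θ (volume.restrict D)
  bddAbove : ∀ K ⊆ D, IsCompact K → BddAbove (θ '' K)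

theorem _root_.UpperSemicontinuousOn.isWeight {D : Set (Fin n → ℂ)} {ψ : (Fin n → ℂ) → ℝ}
    (hψ : UpperSemicontinuousOn ψ D) (hD : IsOpen D) : IsWeight D ψ where
  isOpen := hD
  aemeasurable := aemeasurable_restrict_of_measurable_subtype hD.measurableSet
    (upperSemicontinuousOn_iff_restrict.2 hψ).measurable
  bddAbove _ hK hKc := (hψ.mono hK).bddAbove_of_isCompact hKc

section weight

variable {D : Set (Fin n → ℂ)} {θ : (Fin n → ℂ) → ℝ}

theorem IsWeight.ae_eq (hθ : IsWeight D θ) :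
    ae (weightedMeasure D θ) = ae (volume.restrict D) := by
  have := hθ.aemeasurable
  refine le_antisymm (withDensity_absolutelyContinuous _ _).ae_le
    (withDensity_absolutelyContinuous' (by fun_prop)
      (Filter.Eventually.of_forall fun z => by simp [Real.exp_pos])).ae_le

theorem IsWeight.integrable_iff (hθ : IsWeight D θ) {E : Type*} [NormedAddCommGroup E]
    [NormedSpace ℝ E] {f : (Fin n → ℂ) → E} :
    Integrable f (weightedMeasure D θ) ↔ IntegrableOn (fun z => Real.exp (-θ z) • f z) D := by
  have := hθ.aemeasurable
  rw [weightedMeasure, integrable_withDensity_iff_integrable_smul₀' (by fun_prop) (by simp)]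
  simp [IntegrableOn, ENNReal.toReal_ofReal (Real.exp_pos _).le]

theorem IsWeight.integral_eq (hθ : IsWeight D θ) {E : Type*} [NormedAddCommGroup E]
    [NormedSpace ℝ E] (f : (Fin n → ℂ) → E) :
    ∫ z, f z ∂weightedMeasure D θ = ∫ z in D, Real.exp (-θ z) • f z := by
  have := hθ.aemeasurable
  rw [weightedMeasure, integral_withDensity_eq_integral_toReal_smul₀ (by fun_prop) (by simp)]
  simp [ENNReal.toReal_ofReal (Real.exp_pos _).le]

theorem IsWeight.aestronglyMeasurable_iff (hθ : IsWeight D θ) {f : (Fin n → ℂ) → ℂ} :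
    AEStronglyMeasurable f (weightedMeasure D θ) ↔ AEStronglyMeasurable f (volume.restrict D) :=
  ⟨fun h => h.mono_ac (Measure.ae_le_iff_absolutelyContinuous.1 hθ.ae_eq.ge),
    fun h => h.mono_ac (Measure.ae_le_iff_absolutelyContinuous.1 hθ.ae_eq.le)⟩

/-- An upper bound for `θ` on a compact set bounds `e^{-θ}` from below there, so weighted `L²`
embeds in local `L²` and hence in local `L¹`. -/
theorem IsWeight.locallyIntegrableOn (hθ : IsWeight D θ) {u : (Fin n → ℂ) → ℂ}
    (hu : MemLp u 2 (weightedMeasure D θ)) : LocallyIntegrableOn u D volume := by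
  rw [locallyIntegrableOn_iff hθ.isOpen.isLocallyClosed]
  intro K hK hKc
  obtain ⟨C, hC⟩ := hθ.bddAbove _ hK hKc
  have hm : AEStronglyMeasurable u (volume.restrict K) :=
    (hθ.aestronglyMeasurable_iff.1 hu.1).mono_measure (Measure.restrict_mono hK le_rfl)
  have h1 := (hθ.integrable_iff.1 ((memLp_two_iff_integrable_sq_norm hu.1).1 hu)).mono_set hK
  have : IsFiniteMeasure (volume.restrict K) := ⟨by simpa using hKc.measure_lt_top⟩
  refine MemLp.integrable (q := 2) (by norm_num) ((memLp_two_iff_integrable_sq_norm hm).2 ?_)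
  refine (h1.const_mul (Real.exp C)).mono' (hm.norm.pow 2) ?_
  filter_upwards [ae_restrict_mem hKc.measurableSet] with z hz
  rw [smul_eq_mul, ← mul_assoc, ← Real.exp_add, Real.norm_of_nonneg (by positivity)]
  have : θ z ≤ C := hC (Set.mem_image_of_mem _ hz)
  exact le_mul_of_one_le_left (by positivity) (Real.one_le_exp (by linarith))

/-- Integration against a compactly supported continuous function is represented by an element
of the weighted `L²` space. -/
theorem IsWeight.exists_inner_eq (hθ : IsWeight D θ) {κ : (Fin n → ℂ) → ℂ} (hκ : Continuous κ)
    (hc : HasCompactSupport κ) (hs : tsupport κ ⊆ D) :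
    ∃ e : L2 D θ, ∀ h : L2 D θ, inner ℂ e h = ∫ z in D, h z * κ z := by
  have hθm := hθ.aemeasurable
  -- The representing element is `e^θ κ̄`. Its squared norm is `∫ |κ|² e^θ`, finite by the upper
  -- bound of `θ` on the support; no lower bound is needed.
  have hm : AEStronglyMeasurable (fun z => (Real.exp (θ z) : ℂ) * star (κ z))
      (weightedMeasure D θ) := by
    rw [hθ.aestronglyMeasurable_iff]
    refine AEStronglyMeasurable.mul ?_ hκ.star.aestronglyMeasurable
    have : AEMeasurable (fun z => (Real.exp (θ z) : ℂ)) (volume.restrict D) := by fun_prop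
    exact this.aestronglyMeasurable
  have hL : MemLp (fun z => (Real.exp (θ z) : ℂ) * star (κ z)) 2 (weightedMeasure D θ) := by
    rw [memLp_two_iff_integrable_sq_norm hm, hθ.integrable_iff]
    obtain ⟨C, hC⟩ := hθ.bddAbove _ hs hc
    have hcs : HasCompactSupport fun z => ‖κ z‖ ^ 2 :=
      hc.comp_left (g := fun x : ℂ => ‖x‖ ^ 2) (by simp)
    have h1 : Integrable fun z => Real.exp C * ‖κ z‖ ^ 2 :=
      (Continuous.integrable_of_hasCompactSupport (by fun_prop) hcs).const_mul _
    refine h1.integrableOn.mono' ?_ (Filter.Eventually.of_forall fun z => ?_)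
    · have : AEMeasurable (fun z => Real.exp (-θ z)) (volume.restrict D) := by fun_prop
      exact this.aestronglyMeasurable.smul ((hθ.aestronglyMeasurable_iff.1 hm).norm.pow 2)
    · rw [norm_mul, norm_star, Complex.norm_real, Real.norm_of_nonneg (Real.exp_pos _).le,
        Real.norm_of_nonneg (by positivity), smul_eq_mul, mul_pow, ← mul_assoc, sq (Real.exp _),
        ← mul_assoc, ← Real.exp_add, neg_add_cancel, Real.exp_zero, one_mul]
      by_cases hz : z ∈ tsupport κ
      · exact mul_le_mul_of_nonneg_right
          (Real.exp_le_exp.2 (hC (Set.mem_image_of_mem _ hz))) (by positivity)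
      · simp [image_eq_zero_of_notMem_tsupport hz]
  refine ⟨hL.toLp, fun h => ?_⟩
  rw [L2.inner_def]
  have h1 : ∫ z, inner ℂ ((hL.toLp : L2 D θ) z) (h z) ∂weightedMeasure D θ
      = ∫ z, h z * ((Real.exp (θ z) : ℂ) * κ z) ∂weightedMeasure D θ := by
    refine integral_congr_ae (hL.coeFn_toLp.mono fun z hz => ?_)
    simp only
    rw [hz]
    simp only [RCLike.inner_apply, map_mul, Complex.conj_ofReal, Complex.star_def,
      Complex.conj_conj]
  rw [h1, hθ.integral_eq]
  refine integral_congr_ae (Filter.Eventually.of_forall fun z => ?_)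
  have h2 : (Real.exp (-θ z) : ℂ) * (Real.exp (θ z) : ℂ) = 1 := by
    rw [← Complex.ofReal_mul, ← Real.exp_add, neg_add_cancel, Real.exp_zero, Complex.ofReal_one]
  simp only [Complex.real_smul]
  linear_combination (h z * κ z) * h2

theorem IsWeakDbar.congr {u u' : (Fin n → ℂ) → ℂ} {f f' : Fin n → (Fin n → ℂ) → ℂ}
    (h : IsWeakDbar D u f) (hu : u =ᵐ[volume.restrict D] u')
    (hf : ∀ j, f j =ᵐ[volume.restrict D] f' j) : IsWeakDbar D u' f' := by
  refine ⟨h.1.congr hu, fun j => (h.2.1 j).congr (hf j), fun χ hχ j => ?_⟩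
  have h1 : ∫ z in D, u' z * dzbar j χ z = ∫ z in D, u z * dzbar j χ z :=
    integral_congr_ae (hu.mono fun z hz => by simp only [hz])
  have h2 : ∫ z in D, f' j z * χ z = ∫ z in D, f j z * χ z :=
    integral_congr_ae ((hf j).mono fun z hz => by simp only [hz])
  rw [h1, h2, h.2.2 χ hχ j]

theorem IsWeight.mem_dbarGraph_iff (hθ : IsWeight D θ) {u : L2 D θ} {f : L2Form D θ} :
    (u, f) ∈ dbarGraph D θ ↔ IsWeakDbar D u fun j => f j := by
  refine ⟨?_, fun h => ⟨u, fun j => f j, Filter.EventuallyEq.rfl,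
    fun j => Filter.EventuallyEq.rfl, h⟩⟩
  rintro ⟨u', f', hu, hf, h⟩
  simp only [hθ.ae_eq] at hu hf
  exact h.congr hu.symm fun j => (hf j).symm

theorem IsWeight.isWeakDbar_dbar (hθ : IsWeight D θ) (u : (dbar D θ).domain) :
    IsWeakDbar D (u : L2 D θ) fun j => dbar D θ u j := by
  rw [← hθ.mem_dbarGraph_iff, ← dbar_graph hθ.isOpen hθ.aemeasurable]
  exact (dbar D θ).mem_graph u

theorem IsWeight.exists_dbar_eq (hθ : IsWeight D θ) {u : L2 D θ} {f : L2Form D θ}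
    (h : IsWeakDbar D u fun j => f j) : ∃ hu : u ∈ (dbar D θ).domain, dbar D θ ⟨u, hu⟩ = f := by
  rw [← hθ.mem_dbarGraph_iff, ← dbar_graph hθ.isOpen hθ.aemeasurable,
    LinearPMap.mem_graph_iff] at h
  obtain ⟨⟨y, hy⟩, rfl, hf⟩ := h
  exact ⟨hy, hf⟩

theorem IsWeight.exists_T₂_eq (hθ : IsWeight D θ) {u : L2Tuple p D θ} {f : L2FormTuple p D θ}
    (h : ∀ i, IsWeakDbar D (u i) fun j => f i j) :
    ∃ hu : u ∈ (T₂ p D θ).domain, T₂ p D θ ⟨u, hu⟩ = f := by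
  have h1 := fun i => hθ.exists_dbar_eq (h i)
  refine ⟨fun i => (h1 i).1, ?_⟩
  ext i : 1
  exact (h1 i).2

end weight

/-! ### The `L²` estimate from optimality -/

theorem ofReal_norm_sq_eq_lintegral {α : Type*} [MeasurableSpace α] {μ : Measure α}
    (f : Lp ℂ 2 μ) : ENNReal.ofReal (‖f‖ ^ 2) = ∫⁻ z, ‖f z‖ₑ ^ 2 ∂μ := by
  have h := eLpNorm_nnreal_pow_eq_lintegral (μ := μ) (f := f) (p := 2) two_ne_zero
  have h2 : ((2 : NNReal) : ℝ) = (2 : ℕ) := by norm_num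
  simp only [h2, ENNReal.rpow_natCast] at h
  rw [ENNReal.ofReal_pow (norm_nonneg _), ofReal_norm, Lp.enorm_def, ← h]
  rfl

theorem norm_sq_eq_integral {α : Type*} [MeasurableSpace α] {μ : Measure α}
    (f : Lp ℂ 2 μ) : ‖f‖ ^ 2 = ∫ z, ‖f z‖ ^ 2 ∂μ := by
  rw [← inner_self_eq_norm_sq (𝕜 := ℂ), L2.inner_def, ← integral_re (L2.integrable_inner f f)]
  exact integral_congr_ae (Filter.Eventually.of_forall fun z => inner_self_eq_norm_sq _)

/-- The `L²` estimate for `∂̄` given by `L²`-optimality with the weight `a‖z‖²`. -/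
theorem IsL2Optimal.exists_solution {D : Set (Fin n → ℂ)} {ψ : (Fin n → ℂ) → ℝ}
    (hψ : IsL2Optimal D ψ) {a : ℝ} (ha : 0 < a) (hθ : IsWeight D (quadraticWeight n a + ψ))
    (f : L2Form D (quadraticWeight n a + ψ)) (hf : IsDbarClosed D fun j => f j) :
    ∃ u : L2 D (quadraticWeight n a + ψ), IsWeakDbar D u (fun j => f j) ∧
      a * ‖u‖ ^ 2 ≤ ‖f‖ ^ 2 := by
  set μ := weightedMeasure D (quadraticWeight n a + ψ)
  have hcurv : ∫⁻ z, ENNReal.ofReal (curvatureInvForm (quadraticWeight n a) (fun j => f j) z) ∂μ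
      = ENNReal.ofReal (a⁻¹ * ‖f‖ ^ 2) := by
    have h1 : ∀ z, ENNReal.ofReal (curvatureInvForm (quadraticWeight n a) (fun j => f j) z)
        = ENNReal.ofReal a⁻¹ * ∑ k, ‖f k z‖ₑ ^ 2 := by
      intro z
      rw [curvatureInvForm_quadraticWeight ha, ENNReal.ofReal_mul (by positivity),
        ENNReal.ofReal_sum_of_nonneg fun _ _ => by positivity]
      simp only [ENNReal.ofReal_pow (norm_nonneg _), ofReal_norm]
    simp only [h1]
    rw [lintegral_const_mul' _ _ ENNReal.ofReal_ne_top, lintegral_finsetSum']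
    · rw [ENNReal.ofReal_mul (by positivity), PiLp.norm_sq_eq_of_L2,
        ENNReal.ofReal_sum_of_nonneg fun _ _ => by positivity]
      simp only [ofReal_norm_sq_eq_lintegral]
      rfl
    · exact fun k _ => (Lp.aestronglyMeasurable (f k)).enorm.pow_const 2
  obtain ⟨u, hu, hw, hle⟩ := hψ _ (isSmoothStrictlyPsh_quadraticWeight ha) (fun j => f j)
    (fun j => Lp.memLp (f j)) hf (by rw [hcurv]; exact ENNReal.ofReal_lt_top)
  have hcoe := hu.coeFn_toLp
  refine ⟨hu.toLp, hw.congr ?_ fun j => Filter.EventuallyEq.rfl, ?_⟩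
  · rw [← hθ.ae_eq]
    exact hcoe.symm
  · rw [hcurv] at hle
    have h2 : ENNReal.ofReal (‖hu.toLp‖ ^ 2) ≤ ENNReal.ofReal (a⁻¹ * ‖f‖ ^ 2) := by
      rw [ofReal_norm_sq_eq_lintegral]
      refine le_trans (le_of_eq (lintegral_congr_ae (hcoe.mono fun z hz => ?_))) hle
      simp only [hz]
    rw [ENNReal.ofReal_le_ofReal_iff (by positivity)] at h2
    rwa [inv_mul_eq_div, le_div_iff₀' ha] at h2

/-! ### The operators `T₁`, `T₂` and their adjoints -/

section operators

variable {D : Set (Fin n → ℂ)} {θ : (Fin n → ℂ) → ℝ}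
  {g : Fin p → (Fin n → ℂ) → ℂ}

theorem IsWeight.memLp_mul (hθ : IsWeight D θ) (u : L2 D θ) {G : (Fin n → ℂ) → ℂ}
    (hG : ContinuousOn G D) {C : ℝ} (hC : ∀ z ∈ D, ‖G z‖ ≤ C) :
    MemLp (fun z => u z * G z) 2 (weightedMeasure D θ) := by
  have hGm : AEStronglyMeasurable G (weightedMeasure D θ) :=
    hθ.aestronglyMeasurable_iff.2 (hG.aestronglyMeasurable hθ.isOpen.measurableSet)
  refine (Lp.memLp u).of_le_mul (c := C) ((Lp.aestronglyMeasurable u).mul hGm) ?_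
  rw [hθ.ae_eq]
  filter_upwards [ae_restrict_mem hθ.isOpen.measurableSet] with z hz
  rw [norm_mul, mul_comm]
  exact mul_le_mul_of_nonneg_right (hC z hz) (norm_nonneg _)

theorem coeFn_holderL (φ : (Fin n → ℂ) → ℝ) {G : (Fin n → ℂ) → ℂ}
    (hG : MemLp G ∞ (weightedMeasure D φ)) (h : L2 D φ) :
    ((ContinuousLinearMap.mul ℂ ℂ).holderL (weightedMeasure D φ) ∞ 2 2 hG.toLp h : L2 D φ)
      =ᵐ[weightedMeasure D φ] fun z => G z * h z := by
  rw [ContinuousLinearMap.holderL_apply_apply]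
  filter_upwards [ContinuousLinearMap.coeFn_holder (r := 2) (ContinuousLinearMap.mul ℂ ℂ) hG.toLp h,
    hG.coeFn_toLp] with z h1 h2
  rw [h1, h2]
  rfl

theorem coeFn_T₁ (hg : ∀ i, MemLp (g i) ∞ (weightedMeasure D θ)) (h : L2Tuple p D θ) :
    T₁ D θ g hg h =ᵐ[weightedMeasure D θ] fun z => ∑ i, h i z * g i z := by
  have h1 : T₁ D θ g hg h = ∑ i, ((ContinuousLinearMap.mul ℂ ℂ).holderL (weightedMeasure D θ)
      ∞ 2 2 (hg i).toLp (h i) : L2 D θ) := by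
    simp [T₁]
  rw [h1]
  have h2 := fun i => coeFn_holderL θ (hg i) (h i)
  filter_upwards [Lp.coeFn_finsetSum Finset.univ fun i => ((ContinuousLinearMap.mul ℂ ℂ).holderL
    (weightedMeasure D θ) ∞ 2 2 (hg i).toLp (h i) : L2 D θ), ae_all_iff.2 h2] with z h3 h4
  rw [h3, Finset.sum_apply]
  exact Finset.sum_congr rfl fun i _ => by rw [h4, mul_comm]

theorem coeFn_T₁_adjoint (hg : ∀ i, MemLp (g i) ∞ (weightedMeasure D θ)) (u : L2 D θ) (i : Fin p) :
    (T₁ D θ g hg).adjoint u i =ᵐ[weightedMeasure D θ] fun z => u z * star (g i z) := by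
  have hm : ∀ i, MemLp (fun z => star (g i z)) ∞ (weightedMeasure D θ) := fun i => (hg i).star
  set w : L2Tuple p D θ := WithLp.toLp 2 fun i =>
    (ContinuousLinearMap.mul ℂ ℂ).holderL (weightedMeasure D θ) ∞ 2 2 (hm i).toLp u with hw
  have h1 : (T₁ D θ g hg).adjoint u = w := by
    refine ext_inner_right ℂ fun h => ?_
    rw [ContinuousLinearMap.adjoint_inner_left, PiLp.inner_apply]
    have h2 : T₁ D θ g hg h = ∑ i, ((ContinuousLinearMap.mul ℂ ℂ).holderL (weightedMeasure D θ)
        ∞ 2 2 (hg i).toLp (h i) : L2 D θ) := by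
      simp [T₁]
    rw [h2, inner_sum]
    refine Finset.sum_congr rfl fun i _ => ?_
    rw [L2.inner_def, L2.inner_def]
    refine integral_congr_ae ?_
    filter_upwards [coeFn_holderL θ (hg i) (h i), coeFn_holderL θ (hm i) u] with z h3 h4
    rw [h3, show w i z = _ from h4]
    simp only [RCLike.inner_apply, map_mul, Complex.star_def, Complex.conj_conj]
    ring
  rw [h1]
  filter_upwards [coeFn_holderL θ (hm i) u] with z h4
  rw [show w i z = _ from h4, mul_comm]

/-- Pointwise, `|T₁*u|² = |u|² |g|²`. -/
theorem T₁_adjoint_norm_sq_ge (hθ : IsWeight D θ) (hg : ∀ i, MemLp (g i) ∞ (weightedMeasure D θ))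
    {m : ℝ} (hm : ∀ z ∈ D, m ≤ ∑ i, ‖g i z‖ ^ 2) (u : L2 D θ) :
    m * ‖u‖ ^ 2 ≤ ‖(T₁ D θ g hg).adjoint u‖ ^ 2 := by
  have hi : ∀ v : L2 D θ, Integrable (fun z => ‖v z‖ ^ 2) (weightedMeasure D θ) := fun v =>
    (memLp_two_iff_integrable_sq_norm (Lp.aestronglyMeasurable v)).1 (Lp.memLp v)
  rw [PiLp.norm_sq_eq_of_L2]
  simp only [norm_sq_eq_integral]
  rw [← integral_const_mul, ← integral_finsetSum _ fun i _ => hi _]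
  refine integral_mono_ae ((hi u).const_mul _) (integrable_finsetSum _ fun i _ => hi _) ?_
  have hae := ae_all_iff.2 fun i => coeFn_T₁_adjoint hg u i
  have hD : ∀ᵐ z ∂weightedMeasure D θ, z ∈ D := by
    rw [hθ.ae_eq]
    exact ae_restrict_mem hθ.isOpen.measurableSet
  filter_upwards [hae, hD] with z hz hzD
  simp only [hz, norm_mul, norm_star, mul_pow, ← Finset.mul_sum]
  rw [mul_comm]
  exact mul_le_mul_of_nonneg_left (hm z hzD) (by positivity)

/-- For weakly holomorphic `u`, the tuple `T₁* u = (u ḡ₁, …, u ḡ_p)` is in the domain of `T₂`,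
with a bound on its image. -/
theorem exists_dbar_T₁_adjoint (hθ : IsWeight D θ)
    (hg : ∀ i, MemLp (g i) ∞ (weightedMeasure D θ)) (hgd : ∀ i, DifferentiableOn ℂ (g i) D)
    {M : ℝ} (hM : ∀ z ∈ D, ∑ i, ∑ k, ‖dz k (g i) z‖ ^ 2 ≤ M) (u : L2 D θ) (hu : IsWeakDbar D u 0) :
    ∃ F : L2FormTuple p D θ, (∀ i, IsWeakDbar D ((T₁ D θ g hg).adjoint u i) fun j => F i j) ∧
      ‖F‖ ^ 2 ≤ M * ‖u‖ ^ 2 := by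
  have hgs : ∀ i, ContDiffOn ℝ ∞ (fun z => star (g i z)) D := fun i =>
    Complex.conjCLE.contDiff.comp_contDiffOn (contDiffOn_real_of_differentiableOn hθ.isOpen (hgd i))
  have hc : ∀ i j, ContinuousOn (dzbar j fun z => star (g i z)) D := by
    intro i j
    have : ContinuousOn (fderiv ℝ fun z => star (g i z)) D :=
      (hgs i).continuousOn_fderiv_of_isOpen hθ.isOpen (by simp)
    unfold dzbar
    fun_prop
  -- Since `∂ḡ_i/∂z̄_j` is the conjugate of `∂g_i/∂z_j`, the bound on `|∂g|²` controls it.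
  have hb : ∀ i j, ∀ z ∈ D, ‖dzbar j (fun z => star (g i z)) z‖ ≤ √M := by
    intro i j z hz
    rw [dzbar_star, norm_star]
    refine Real.le_sqrt_of_sq_le (le_trans ?_ (hM z hz))
    refine le_trans ?_ (Finset.single_le_sum (f := fun i => ∑ k, ‖dz k (g i) z‖ ^ 2)
      (fun _ _ => by positivity) (Finset.mem_univ i))
    exact Finset.single_le_sum (f := fun k => ‖dz k (g i) z‖ ^ 2)
      (fun _ _ => by positivity) (Finset.mem_univ j)
  have hL := fun i j => hθ.memLp_mul u (hc i j) (hb i j)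
  set F : L2FormTuple p D θ := WithLp.toLp 2 fun i => WithLp.toLp 2 fun j => (hL i j).toLp with hF
  have hFae : ∀ i j, F i j =ᵐ[weightedMeasure D θ]
      fun z => u z * dzbar j (fun z => star (g i z)) z := fun i j => (hL i j).coeFn_toLp
  refine ⟨F, fun i => ?_, ?_⟩
  · have h1 := coeFn_T₁_adjoint hg u i
    have h2 := hFae i
    simp only [hθ.ae_eq] at h1 h2
    exact (hu.mul_contDiffOn hθ.isOpen (hgs i)).congr h1.symm fun j => (h2 j).symm
  · have hi : ∀ v : L2 D θ, Integrable (fun z => ‖v z‖ ^ 2) (weightedMeasure D θ) := fun v =>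
      (memLp_two_iff_integrable_sq_norm (Lp.aestronglyMeasurable v)).1 (Lp.memLp v)
    rw [PiLp.norm_sq_eq_of_L2]
    simp only [PiLp.norm_sq_eq_of_L2, norm_sq_eq_integral]
    simp only [← integral_finsetSum Finset.univ fun j _ => hi _]
    rw [← integral_const_mul,
      ← integral_finsetSum _ fun i _ => integrable_finsetSum _ fun j _ => hi _]
    refine integral_mono_ae (integrable_finsetSum _ fun i _ => integrable_finsetSum _ fun j _ => hi _)
      ((hi u).const_mul _) ?_
    have hD : ∀ᵐ z ∂weightedMeasure D θ, z ∈ D := by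
      rw [hθ.ae_eq]
      exact ae_restrict_mem hθ.isOpen.measurableSet
    filter_upwards [ae_all_iff.2 fun i => ae_all_iff.2 (hFae i), hD] with z hz hzD
    simp only [hz, norm_mul, mul_pow, dzbar_star, norm_star, ← Finset.mul_sum]
    rw [mul_comm]
    exact mul_le_mul_of_nonneg_right (hM z hzD) (by positivity)

/-- The weakly holomorphic elements of `L²(D, θ)`. -/
noncomputable def holomorphicL2 (D : Set (Fin n → ℂ)) (θ : (Fin n → ℂ) → ℝ) :
    Submodule ℂ (L2 D θ) :=
  (dbarGraph D θ).comap (LinearMap.inl ℂ (L2 D θ) (L2Form D θ))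

theorem IsWeight.mem_holomorphicL2_iff (hθ : IsWeight D θ) {u : L2 D θ} :
    u ∈ holomorphicL2 D θ ↔ IsWeakDbar D u 0 := by
  have h : u ∈ holomorphicL2 D θ ↔ (u, (0 : L2Form D θ)) ∈ dbarGraph D θ := Iff.rfl
  have h0 : ∀ j, ((0 : L2Form D θ) j : (Fin n → ℂ) → ℂ) =ᵐ[volume.restrict D] 0 := by
    intro j
    rw [← hθ.ae_eq]
    exact Lp.coeFn_zero _ _ _
  rw [h, hθ.mem_dbarGraph_iff]
  exact ⟨fun h => h.congr Filter.EventuallyEq.rfl h0,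
    fun h => h.congr Filter.EventuallyEq.rfl fun j => (h0 j).symm⟩

/-- An intersection of kernels of the functionals `u ↦ ∫ u ∂̄_jχ`, which are continuous by
`IsWeight.exists_inner_eq`. -/
theorem IsWeight.isClosed_holomorphicL2 (hθ : IsWeight D θ) :
    IsClosed (holomorphicL2 D θ : Set (L2 D θ)) := by
  have h : (holomorphicL2 D θ : Set (L2 D θ)) =
      ⋂ (χ : (Fin n → ℂ) → ℂ) (_ : IsTestFunction D χ) (j : Fin n),
        {u : L2 D θ | ∫ z in D, u z * dzbar j χ z = 0} := by
    ext u
    simp only [SetLike.mem_coe, hθ.mem_holomorphicL2_iff, Set.mem_iInter, Set.mem_ofPred_eq]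
    refine ⟨fun h χ hχ j => by simpa using h.2.2 χ hχ j, fun h =>
      ⟨hθ.locallyIntegrableOn (Lp.memLp u), fun _ => locallyIntegrableOn_zero, fun χ hχ j => ?_⟩⟩
    simpa using h χ hχ j
  rw [h]
  refine isClosed_iInter fun χ => isClosed_iInter fun hχ => isClosed_iInter fun j => ?_
  have hχ' := hχ.dzbar j
  obtain ⟨e, he⟩ := hθ.exists_inner_eq hχ'.1.continuous hχ'.2.1 hχ'.2.2
  simp only [← he]
  exact isClosed_eq (by fun_prop) continuous_const

theorem T₁_mem_holomorphicL2 (hθ : IsWeight D θ) (hg : ∀ i, MemLp (g i) ∞ (weightedMeasure D θ))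
    (hgd : ∀ i, DifferentiableOn ℂ (g i) D) {h : L2Tuple p D θ}
    (hh : ∀ i, h i ∈ holomorphicL2 D θ) : T₁ D θ g hg h ∈ holomorphicL2 D θ := by
  have h1 : T₁ D θ g hg h = ∑ i, ((ContinuousLinearMap.mul ℂ ℂ).holderL (weightedMeasure D θ)
      ∞ 2 2 (hg i).toLp (h i) : L2 D θ) := by
    simp [T₁]
  rw [h1]
  refine Submodule.sum_mem _ fun i _ => ?_
  have h2 := coeFn_holderL θ (hg i) (h i)
  rw [hθ.ae_eq] at h2
  rw [hθ.mem_holomorphicL2_iff]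
  refine ((hθ.mem_holomorphicL2_iff.1 (hh i)).mul_contDiffOn hθ.isOpen
    (contDiffOn_real_of_differentiableOn hθ.isOpen (hgd i))).congr
      (h2.symm.mono fun z hz => by rw [← hz]; exact mul_comm _ _) fun j => ?_
  filter_upwards [ae_restrict_mem hθ.isOpen.measurableSet] with z hz
  rw [dzbar_eq_zero ((hgd i).differentiableAt (hθ.isOpen.mem_nhds hz)), mul_zero]
  rfl

/-- Continuity bounds `θ` from below on compact sets, so that `e^{-θ}` is bounded there; upper
semicontinuity would not suffice for this argument. -/
theorem memLp_of_hasCompactSupport (hθ : IsWeight D θ) (hθc : ContinuousOn θ D)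
    {κ : (Fin n → ℂ) → ℂ} (hκ : Continuous κ) (hc : HasCompactSupport κ) (hs : tsupport κ ⊆ D) :
    MemLp κ 2 (weightedMeasure D θ) := by
  rw [memLp_two_iff_integrable_sq_norm (hθ.aestronglyMeasurable_iff.2 hκ.aestronglyMeasurable),
    hθ.integrable_iff]
  have h1 : IntegrableOn (fun z => Real.exp (-θ z) • ‖κ z‖ ^ 2) (tsupport κ) := by
    have := hθc.mono hs
    exact ContinuousOn.integrableOn_compact hc (by fun_prop)
  refine h1.of_forall_sdiff_eq_zero hθ.isOpen.measurableSet fun z hz => ?_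
  simp [image_eq_zero_of_notMem_tsupport hz.2]

theorem IsTestFunction.isWeakDbar (hD : IsOpen D) {χ : (Fin n → ℂ) → ℂ} (hχ : IsTestFunction D χ) :
    IsWeakDbar D χ fun j => L2Division.dzbar j χ := by
  refine ⟨hχ.1.continuous.locallyIntegrable.locallyIntegrableOn _,
    fun j => (hχ.continuous_dzbar j).locallyIntegrable.locallyIntegrableOn _, fun η hη j => ?_⟩
  have hli := hχ.1.continuous.locallyIntegrable.locallyIntegrableOn (μ := volume) D
  have hli' := (hχ.continuous_dzbar j).locallyIntegrable.locallyIntegrableOn (μ := volume) D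
  rw [eq_neg_iff_add_eq_zero, ← integral_add, ← integral_dzbar (hη.mul hD hχ.1.contDiffOn) j]
  · refine setIntegral_congr_fun hD.measurableSet fun z hz => ?_
    simp only
    rw [dzbar_mul (hχ.1.contDiffAt.differentiableAt (by simp))
      (hη.1.contDiffAt.differentiableAt (by simp))]
    ring
  · exact integrable_mul_of_support hη hli (hη.continuous_dzbar j) (support_dzbar j)
  · exact integrable_mul_of_support hη hli' hη.1.continuous subset_closure

/-- The domain contains every tuple with one test function as its only nonzero entry. If `h` is
orthogonal to all of these, each `h_i e^{-θ}` annihilates the real test functions and so vanishes.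
-/
theorem dense_T₂_domain (hθ : IsWeight D θ) (hθc : ContinuousOn θ D) :
    Dense ((T₂ p D θ).domain : Set (L2Tuple p D θ)) := by
  rw [Submodule.dense_iff_topologicalClosure_eq_top, Submodule.topologicalClosure_eq_top_iff,
    Submodule.eq_bot_iff]
  intro h hh
  ext i : 1
  have hli := hθ.locallyIntegrableOn (Lp.memLp (h i))
  have hexp : ContinuousOn (fun z => (Real.exp (-θ z) : ℂ)) D := by fun_prop
  have h0 := hθ.isOpen.ae_eq_zero_of_integral_contDiff_smul_eq_zero
    (hli.mul_continuousOn hexp hθ.isOpen.isLocallyClosed) fun χ hχ hχc hχs => ?_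
  · have h1 : h i =ᵐ[weightedMeasure D θ] 0 := by
      rw [hθ.ae_eq]
      filter_upwards [(ae_restrict_iff' hθ.isOpen.measurableSet).2 h0] with z hz
      simpa [(Real.exp_pos _).ne'] using hz
    exact Lp.ext (h1.trans (Lp.coeFn_zero _ _ _).symm)
  have hsub : tsupport (fun z => (χ z : ℂ)) ⊆ tsupport χ :=
    closure_mono fun z hz => by simpa using hz
  have ht : IsTestFunction D fun z => (χ z : ℂ) := ⟨Complex.ofRealCLM.contDiff.comp hχ,
    hχc.of_isClosed_subset (isClosed_tsupport _) hsub, hsub.trans hχs⟩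
  have hL := memLp_of_hasCompactSupport hθ hθc ht.1.continuous ht.2.1 ht.2.2
  have hL' := fun j => memLp_of_hasCompactSupport hθ hθc (ht.dzbar j).1.continuous
    (ht.dzbar j).2.1 (ht.dzbar j).2.2
  have hdom : hL.toLp ∈ (dbar D θ).domain := by
    refine (hθ.exists_dbar_eq (f := WithLp.toLp 2 fun j => (hL' j).toLp) ?_).1
    have h1 := hL.coeFn_toLp
    have h2 := fun j => (hL' j).coeFn_toLp
    simp only [hθ.ae_eq] at h1 h2
    exact (ht.isWeakDbar hθ.isOpen).congr h1.symm fun j => (h2 j).symm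
  have hmem : (WithLp.toLp 2 (Pi.single i hL.toLp) : L2Tuple p D θ) ∈ (T₂ p D θ).domain := by
    intro k
    by_cases hk : k = i
    · subst hk
      simpa using hdom
    · simp [Pi.single_eq_of_ne hk]
  have h1 := (Submodule.mem_orthogonal _ _).1 hh _ hmem
  rw [PiLp.inner_apply, Finset.sum_eq_single i (fun b _ hb => by simp [Pi.single_eq_of_ne hb])
    (by simp)] at h1
  simp only [Pi.single_eq_same] at h1
  rw [L2.inner_def] at h1
  have h2 : ∫ z, inner ℂ ((hL.toLp : L2 D θ) z) (h i z) ∂weightedMeasure D θ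
      = ∫ z, h i z * (χ z : ℂ) ∂weightedMeasure D θ := by
    refine integral_congr_ae (hL.coeFn_toLp.mono fun z hz => ?_)
    simp only
    rw [hz]
    simp only [RCLike.inner_apply, Complex.conj_ofReal]
  rw [h2, hθ.integral_eq] at h1
  rw [← setIntegral_eq_integral_of_forall_compl_eq_zero (s := D), ← h1]
  · refine integral_congr_ae (Filter.Eventually.of_forall fun z => ?_)
    simp only [Complex.real_smul]
    ring
  · intro z hz
    simp [image_eq_zero_of_notMem_tsupport fun h => hz (hχs h)]

theorem exists_T₂_adjoint_eq_zero (hd : Dense ((T₂ p D θ).domain : Set (L2Tuple p D θ)))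
    {w : L2FormTuple p D θ} (hw : ∀ h : (T₂ p D θ).domain, inner ℂ w (T₂ p D θ h) = 0) :
    ∃ hw : w ∈ (T₂ p D θ).adjoint.domain, (T₂ p D θ).adjoint ⟨w, hw⟩ = 0 := by
  have h1 : ∀ h : (T₂ p D θ).domain, inner ℂ (0 : L2Tuple p D θ) (h : L2Tuple p D θ)
      = inner ℂ w (T₂ p D θ h) := fun h => by rw [hw, inner_zero_left]
  exact ⟨LinearPMap.mem_adjoint_domain_of_exists w ⟨0, h1⟩,
    LinearPMap.adjoint_apply_eq hd _ h1⟩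

/-- The components of an element of `(Ker T₂*)ᗮ` are `∂̄`-closed. -/
theorem isDbarClosed_of_orthogonal (hθ : IsWeight D θ)
    (hd : Dense ((T₂ p D θ).domain : Set (L2Tuple p D θ))) {v : L2FormTuple p D θ}
    (hv : ∀ w : (T₂ p D θ).adjoint.domain, (T₂ p D θ).adjoint w = 0 →
      inner ℂ (w : L2FormTuple p D θ) v = 0) (i : Fin p) : IsDbarClosed D fun j => v i j := by
  refine ⟨fun j => hθ.locallyIntegrableOn (Lp.memLp _), fun χ hχ j k => ?_⟩
  have hex := fun k => hθ.exists_inner_eq (hχ.dzbar k).1.continuous (hχ.dzbar k).2.1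
    (hχ.dzbar k).2.2
  choose e he using hex
  -- Pairing with `w` measures the failure of the closedness identity for `χ, j, k` in component
  -- `i`. It vanishes on the range of `T₂` by `∂̄² = 0`, so `w ∈ Ker T₂*` and `v` is orthogonal to
  -- it.
  set w : L2FormTuple p D θ := WithLp.toLp 2 (Pi.single i
    (WithLp.toLp 2 (Pi.single j (e k)) - WithLp.toLp 2 (Pi.single k (e j)))) with hw
  have hin : ∀ y : L2FormTuple p D θ, inner ℂ w y =
      (∫ z in D, y i j z * dzbar k χ z) - ∫ z in D, y i k z * dzbar j χ z := by
    intro y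
    have h1 : ∀ (j : Fin n) (e : L2 D θ) (x : L2Form D θ),
        inner ℂ (WithLp.toLp 2 (Pi.single j e) : L2Form D θ) x = inner ℂ e (x j) := by
      intro j e x
      rw [PiLp.inner_apply, Finset.sum_eq_single j]
      · simp
      · intro b _ hb
        simp [Pi.single_eq_of_ne hb]
      · simp
    rw [PiLp.inner_apply, Finset.sum_eq_single i]
    · simp only [hw, Pi.single_eq_same]
      rw [inner_sub_left, h1, h1, he, he]
    · intro b _ hb
      simp [hw, hb]
    · simp
  obtain ⟨hwd, hw0⟩ := exists_T₂_adjoint_eq_zero hd (w := w) fun h => by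
    rw [hin, sub_eq_zero]
    exact (hθ.isWeakDbar_dbar ⟨h.1 i, h.2 i⟩).isDbarClosed.2 χ hχ j k
  have := hv ⟨w, hwd⟩ hw0
  rwa [hin, sub_eq_zero] at this

theorem IsL2Optimal.exists_solution_tuple {ψ : (Fin n → ℂ) → ℝ}
    (hψ : IsL2Optimal D ψ) {a : ℝ} (ha : 0 < a) (hθ : IsWeight D (quadraticWeight n a + ψ))
    (f : L2FormTuple p D (quadraticWeight n a + ψ)) (hf : ∀ i, IsDbarClosed D fun j => f i j) :
    ∃ u : L2Tuple p D (quadraticWeight n a + ψ), (∀ i, IsWeakDbar D (u i) fun j => f i j) ∧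
      a * ‖u‖ ^ 2 ≤ ‖f‖ ^ 2 := by
  choose u hu hle using fun i => hψ.exists_solution ha hθ (f i) (hf i)
  refine ⟨WithLp.toLp 2 u, hu, ?_⟩
  rw [PiLp.norm_sq_eq_of_L2, PiLp.norm_sq_eq_of_L2, Finset.mul_sum]
  exact Finset.sum_le_sum fun i _ => hle i

/-- The Hilbert space core of the first claim, with `x = T₁*u`, `y = T₂*v`, `T₂s = v`, `f = T₂x`, `r
= ‖u‖²`. From `‖v‖² = ⟨y, s⟩ ≤ ‖y‖‖s‖` one gets `a‖v‖² ≤ ‖y‖²`. The cross term `2 Re ⟨v, f⟩` is at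
least `-a‖v‖² - ‖f‖²/a`; the first summand is absorbed by `‖y‖²`, the second costs `(M/a) r`. -/
theorem le_norm_add_sq_of_inner_eq {E F : Type*} [NormedAddCommGroup E] [InnerProductSpace ℂ E]
    [NormedAddCommGroup F] [InnerProductSpace ℂ F] {x y s : E} {v f : F} {a m M r : ℝ}
    (ha : 0 < a) (hx : m * r ≤ ‖x‖ ^ 2) (hs : a * ‖s‖ ^ 2 ≤ ‖v‖ ^ 2) (hf : ‖f‖ ^ 2 ≤ M * r)
    (hys : inner ℂ y s = inner ℂ v v) (hyx : inner ℂ y x = inner ℂ v f) :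
    (m - M / a) * r ≤ ‖x + y‖ ^ 2 := by
  have h2 : a * ‖v‖ ^ 2 ≤ ‖y‖ ^ 2 := by
    have h4 : ‖v‖ ^ 2 ≤ ‖y‖ * ‖s‖ := by
      rw [← inner_self_eq_norm_sq (𝕜 := ℂ), ← hys]
      exact (RCLike.re_le_norm _).trans (norm_inner_le_norm _ _)
    rcases eq_or_lt_of_le (sq_nonneg ‖v‖) with h0 | h0
    · rw [← h0, mul_zero]
      positivity
    · refine le_of_mul_le_mul_right ?_ h0
      calc a * ‖v‖ ^ 2 * ‖v‖ ^ 2 ≤ a * (‖y‖ * ‖s‖) * (‖y‖ * ‖s‖) := by gcongr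
        _ = ‖y‖ ^ 2 * (a * ‖s‖ ^ 2) := by ring
        _ ≤ ‖y‖ ^ 2 * ‖v‖ ^ 2 := by gcongr
  have h3 : |RCLike.re (inner ℂ y x)| ≤ ‖v‖ * ‖f‖ := by
    rw [hyx]
    exact (RCLike.abs_re_le_norm _).trans (norm_inner_le_norm _ _)
  have h4 : 2 * (‖v‖ * ‖f‖) ≤ a * ‖v‖ ^ 2 + ‖f‖ ^ 2 / a := by
    have h5 : 0 ≤ (a * ‖v‖ - ‖f‖) ^ 2 / a := by positivity
    have h6 : (a * ‖v‖ - ‖f‖) ^ 2 / a = a * ‖v‖ ^ 2 + ‖f‖ ^ 2 / a - 2 * (‖v‖ * ‖f‖) := by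
      field_simp
      ring
    linarith
  have h5 : ‖f‖ ^ 2 / a ≤ M / a * r := by
    rw [div_mul_eq_mul_div]
    gcongr
  rw [add_comm x y, norm_add_sq (𝕜 := ℂ) y x]
  have h7 := neg_abs_le (RCLike.re (inner ℂ y x))
  linarith

/-- The lower bound for `T₁* u + T₂* v` when `u` is weakly holomorphic and `v` is `∂̄`-closed. -/
theorem le_norm_sq_adjoint_add_adjoint {ψ : (Fin n → ℂ) → ℝ} (hψ : IsL2Optimal D ψ) {a : ℝ} (ha : 0 < a)
    (hθ : IsWeight D (quadraticWeight n a + ψ))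
    (hg : ∀ i, MemLp (g i) ∞ (weightedMeasure D (quadraticWeight n a + ψ)))
    (hgd : ∀ i, DifferentiableOn ℂ (g i) D) {m M : ℝ} (hm : ∀ z ∈ D, m ≤ ∑ i, ‖g i z‖ ^ 2)
    (hM : ∀ z ∈ D, ∑ i, ∑ k, ‖dz k (g i) z‖ ^ 2 ≤ M)
    (hd : Dense ((T₂ p D (quadraticWeight n a + ψ)).domain :
      Set (L2Tuple p D (quadraticWeight n a + ψ))))
    {u : L2 D (quadraticWeight n a + ψ)} (hu : IsWeakDbar D u 0)
    (v : (T₂ p D (quadraticWeight n a + ψ)).adjoint.domain)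
    (hv : ∀ i, IsDbarClosed D fun j => (v : L2FormTuple p D (quadraticWeight n a + ψ)) i j) :
    (m - M / a) * ‖u‖ ^ 2 ≤ ‖(T₁ D (quadraticWeight n a + ψ) g hg).adjoint u
      + (T₂ p D (quadraticWeight n a + ψ)).adjoint v‖ ^ 2 := by
  have hadj := LinearPMap.adjoint_isFormalAdjoint hd v
  obtain ⟨F, hF, hFM⟩ := exists_dbar_T₁_adjoint hθ hg hgd hM u hu
  obtain ⟨hx, hxF⟩ := hθ.exists_T₂_eq hF
  obtain ⟨s, hs, hsa⟩ := hψ.exists_solution_tuple ha hθ _ hv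
  obtain ⟨hsd, hsv⟩ := hθ.exists_T₂_eq hs
  have h1 := hadj ⟨s, hsd⟩
  have h2 := hadj ⟨_, hx⟩
  rw [hsv] at h1
  rw [hxF] at h2
  exact le_norm_add_sq_of_inner_eq ha (T₁_adjoint_norm_sq_ge hθ hg hm u) hsa hFM h1 h2

/-! ### Surjectivity and division -/

/-- An operator between closed subspaces is onto when its adjoint is bounded below. -/
theorem exists_mem_eq_of_adjoint_bounded_below {H₁ H₀ : Type*} [NormedAddCommGroup H₁]
    [InnerProductSpace ℂ H₁] [CompleteSpace H₁] [NormedAddCommGroup H₀] [InnerProductSpace ℂ H₀]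
    [CompleteSpace H₀] (T : H₁ →L[ℂ] H₀) (A₁ : Submodule ℂ H₁) (A₀ : Submodule ℂ H₀)
    [CompleteSpace A₁] [CompleteSpace A₀] (hT : ∀ h ∈ A₁, T h ∈ A₀) {δ : ℝ} (hδ : 0 < δ)
    (hb : ∀ u ∈ A₀, δ * ‖u‖ ^ 2 ≤ ‖A₁.orthogonalProjectionOnto (T.adjoint u)‖ ^ 2) {f : H₀}
    (hf : f ∈ A₀) : ∃ h ∈ A₁, T h = f := by
  let S : A₁ →L[ℂ] A₀ := (T.comp A₁.subtypeL).codRestrict A₀ fun h => hT h h.2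
  have hS : ∀ u : A₀, S.adjoint u = A₁.orthogonalProjectionOnto (T.adjoint u) := by
    intro u
    refine ext_inner_right ℂ fun h => ?_
    rw [ContinuousLinearMap.adjoint_inner_left, Submodule.inner_orthogonalProjectionOnto_eq_of_mem_right,
      ContinuousLinearMap.adjoint_inner_left]
    rfl
  -- `⟨SS*u, u⟩ = ‖S*u‖² ≥ δ‖u‖²` makes `SS*` invertible; the preimage found below has the form
  -- `S*u`.
  have hu : IsUnit (S.comp S.adjoint) := by
    refine ContinuousLinearMap.isUnit_of_forall_le_norm_inner_map _ (c := ⟨δ, hδ.le⟩) hδ fun u => ?_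
    rw [ContinuousLinearMap.comp_apply, ← ContinuousLinearMap.adjoint_inner_right,
      inner_self_eq_norm_sq_to_K, norm_pow, RCLike.norm_ofReal, abs_norm, hS, mul_comm]
    exact hb u u.2
  obtain ⟨u, hu⟩ := (ContinuousLinearMap.isUnit_iff_bijective.1 hu).2 ⟨f, hf⟩
  exact ⟨S.adjoint u, (S.adjoint u).2, congrArg Subtype.val hu⟩

/-- The components of `w` and `s` orthogonal to `A` coincide, so Pythagoras loses at most `‖s‖²`. -/
theorem le_norm_sq_orthogonalProjection {H : Type*} [NormedAddCommGroup H]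
    [InnerProductSpace ℂ H] (A : Submodule ℂ H) [A.HasOrthogonalProjection] {w s : H}
    (h : w - s ∈ A) : ‖w‖ ^ 2 - ‖s‖ ^ 2 ≤ ‖A.orthogonalProjectionOnto w‖ ^ 2 := by
  have h1 := A.norm_sq_eq_add_norm_sq_projection w
  have h2 : Aᗮ.orthogonalProjectionOnto w = Aᗮ.orthogonalProjectionOnto s := by
    rw [← sub_eq_zero, ← map_sub]
    exact Submodule.orthogonalProjectionOnto_orthogonal_apply_eq_zero h
  have h3 : ‖Aᗮ.orthogonalProjectionOnto s‖ ≤ ‖s‖ := Submodule.norm_orthogonalProjectionOnto_apply_le _ _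
  rw [h2] at h1
  have h4 : ‖Aᗮ.orthogonalProjectionOnto s‖ ^ 2 ≤ ‖s‖ ^ 2 := by gcongr
  linarith

/-- The tuples of weakly holomorphic elements of `L²(D, θ)`. -/
noncomputable def holomorphicL2Tuple (p : ℕ) (D : Set (Fin n → ℂ)) (θ : (Fin n → ℂ) → ℝ) :
    Submodule ℂ (L2Tuple p D θ) :=
  ⨅ i, (holomorphicL2 D θ).comap 
    (PiLp.proj (𝕜 := ℂ) 2 (fun _ : Fin p => L2 D θ) i).toLinearMap

theorem mem_holomorphicL2Tuple {h : L2Tuple p D θ} :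
    h ∈ holomorphicL2Tuple p D θ ↔ ∀ i, h i ∈ holomorphicL2 D θ := by
  simp [holomorphicL2Tuple]

theorem IsWeight.isClosed_holomorphicL2Tuple (hθ : IsWeight D θ) :
    IsClosed (holomorphicL2Tuple p D θ : Set (L2Tuple p D θ)) := by
  have : (holomorphicL2Tuple p D θ : Set (L2Tuple p D θ))
      = ⋂ i, (fun h : L2Tuple p D θ => h i) ⁻¹' (holomorphicL2 D θ) := by
    ext h
    simp [mem_holomorphicL2Tuple]
  rw [this]
  exact isClosed_iInter fun i => hθ.isClosed_holomorphicL2.preimage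
    (PiLp.continuous_apply 2 (fun _ : Fin p => L2 D θ) i)

/-- The division theorem with `L²` estimates in the space of holomorphic functions. -/
theorem exists_holomorphic_division {ψ : (Fin n → ℂ) → ℝ} (hψ : IsL2Optimal D ψ) {a : ℝ}
    (ha : 0 < a) (hθ : IsWeight D (quadraticWeight n a + ψ))
    (hg : ∀ i, MemLp (g i) ∞ (weightedMeasure D (quadraticWeight n a + ψ)))
    (hgd : ∀ i, DifferentiableOn ℂ (g i) D) {m M : ℝ} (hm : ∀ z ∈ D, m ≤ ∑ i, ‖g i z‖ ^ 2)
    (hM : ∀ z ∈ D, ∑ i, ∑ k, ‖dz k (g i) z‖ ^ 2 ≤ M) (hδ : 0 < m - M / a)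
    {f : (Fin n → ℂ) → ℂ} (hf : DifferentiableOn ℂ f D)
    (hfL : MemLp f 2 (weightedMeasure D (quadraticWeight n a + ψ))) :
    ∃ h : Fin p → (Fin n → ℂ) → ℂ,
      (∀ i, DifferentiableOn ℂ (h i) D ∧
        MemLp (h i) 2 (weightedMeasure D (quadraticWeight n a + ψ))) ∧
      ∀ z ∈ D, f z = ∑ i, h i z * g i z := by
  set θ := quadraticWeight n a + ψ
  have : CompleteSpace (holomorphicL2 D θ) := hθ.isClosed_holomorphicL2.completeSpace_coe
  have : CompleteSpace (holomorphicL2Tuple p D θ) :=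
    hθ.isClosed_holomorphicL2Tuple.completeSpace_coe
  have hfA : hfL.toLp ∈ holomorphicL2 D θ := by
    have h1 := hfL.coeFn_toLp
    rw [hθ.ae_eq] at h1
    exact hθ.mem_holomorphicL2_iff.2 ((isWeakDbar_zero_of_differentiableOn hθ.isOpen hf).congr
      h1.symm fun j => Filter.EventuallyEq.rfl)
  obtain ⟨h, hA, hTh⟩ := exists_mem_eq_of_adjoint_bounded_below (T₁ D θ g hg)
    (holomorphicL2Tuple p D θ) (holomorphicL2 D θ)
    (fun h hh => T₁_mem_holomorphicL2 hθ hg hgd (mem_holomorphicL2Tuple.1 hh)) hδ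
    (fun u hu => by
      obtain ⟨F, hF, hFM⟩ :=
        exists_dbar_T₁_adjoint hθ hg hgd hM u (hθ.mem_holomorphicL2_iff.1 hu)
      obtain ⟨s, hs, hsa⟩ := hψ.exists_solution_tuple ha hθ F fun i => (hF i).isDbarClosed
      -- Both terms have the same `∂̄`, namely `F`.
      have h1 : (T₁ D θ g hg).adjoint u - s ∈ holomorphicL2Tuple p D θ := by
        rw [mem_holomorphicL2Tuple]
        intro i
        have h2 := (dbarGraph D θ).sub_mem (hθ.mem_dbarGraph_iff.2 (hF i))
          (hθ.mem_dbarGraph_iff.2 (hs i))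
        rw [Prod.mk_sub_mk, sub_self] at h2
        exact h2
      have h2 := le_norm_sq_orthogonalProjection _ h1
      have h3 := T₁_adjoint_norm_sq_ge hθ hg hm u
      have h4 : ‖s‖ ^ 2 ≤ M / a * ‖u‖ ^ 2 := by
        rw [div_mul_eq_mul_div, le_div_iff₀' ha]
        exact hsa.trans hFM
      linarith) hfA
  rw [mem_holomorphicL2Tuple] at hA
  choose H hH hHae using fun i =>
    (hθ.mem_holomorphicL2_iff.1 (hA i)).exists_differentiableOn hθ.isOpen
  refine ⟨H, fun i => ⟨hH i, (Lp.memLp (h i)).ae_eq (by rw [hθ.ae_eq]; exact hHae i)⟩, ?_⟩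
  have hae : f =ᵐ[volume.restrict D] fun z => ∑ i, H i z * g i z := by
    have h1 := coeFn_T₁ hg h
    rw [hTh] at h1
    have h2 := hfL.coeFn_toLp.symm.trans h1
    rw [hθ.ae_eq] at h2
    filter_upwards [h2, ae_all_iff.2 hHae] with z h3 h4
    rw [h3]
    exact Finset.sum_congr rfl fun i _ => by rw [h4]
  -- Both sides are continuous on the open set `D`, so equality almost everywhere becomes equality
  -- everywhere.
  exact Measure.eqOn_open_of_ae_eq hae hθ.isOpen hf.continuousOn
    (continuousOn_finsetSum _ fun i _ => (hH i).continuousOn.mul (hgd i).continuousOn)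

end operators

end L2Division

open L2Division MeasureTheory
theorem mainTheorem2 {n p : ℕ} (D : Set (Fin n → ℂ)) (hD : IsOpen D) (hDc : IsConnected D)
    (g : Fin p → (Fin n → ℂ) → ℂ) (hg : ∀ i, DifferentiableOn ℂ (g i) D)
    (hinf : 0 < ⨅ z : D, ∑ i, ‖g i z‖ ^ 2)
    (hsup : BddAbove ((fun z => ∑ i, ‖g i z‖ ^ 2) '' D))
    (hdsup : BddAbove ((fun z => ∑ i, ∑ k, ‖dz k (g i) z‖ ^ 2) '' D)) :
    ∃ a₀ δ : ℝ, 0 < a₀ ∧ 0 < δ ∧ ∀ a : ℝ, a₀ ≤ a →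
      ∀ φ ψ : (Fin n → ℂ) → ℝ, φ = quadraticWeight n a →
        UpperSemicontinuousOn ψ D → IsL2Optimal D ψ →
        (ContinuousOn ψ D →
          ∀ u : (dbar D (φ + ψ)).domain, dbar D (φ + ψ) u = 0 →
          ∀ v : (T₂ p D (φ + ψ)).adjoint.domain,
            (∀ w : (T₂ p D (φ + ψ)).adjoint.domain, (T₂ p D (φ + ψ)).adjoint w = 0 →
              inner ℂ (w : L2FormTuple p D (φ + ψ)) v = 0) →
            δ * ‖(u : L2 D (φ + ψ))‖ ^ 2 ≤
              ‖(T₁ D (φ + ψ) g (memLp_top_of_bounded hD (φ + ψ) hg hsup)).adjoint u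
                + (T₂ p D (φ + ψ)).adjoint v‖ ^ 2) ∧
        ∀ f : (Fin n → ℂ) → ℂ, DifferentiableOn ℂ f D →
          MemLp f 2 (weightedMeasure D (φ + ψ)) →
          ∃ h : Fin p → (Fin n → ℂ) → ℂ,
            (∀ i, DifferentiableOn ℂ (h i) D ∧ MemLp (h i) 2 (weightedMeasure D (φ + ψ))) ∧
            ∀ z ∈ D, f z = ∑ i, h i z * g i z := by
  set m := ⨅ z : D, ∑ i, ‖g i z‖ ^ 2
  have hm : ∀ z ∈ D, m ≤ ∑ i, ‖g i z‖ ^ 2 := fun z hz =>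
    ciInf_le (f := fun z : D => ∑ i, ‖g i z‖ ^ 2)
      ⟨0, by rintro _ ⟨z, rfl⟩; positivity⟩ ⟨z, hz⟩
  obtain ⟨M₀, hM₀⟩ := hdsup
  -- The maximum with `1` keeps `a₀ = 2M/m` positive. For `a ≥ a₀` the loss `M/a` is at most `m/2`,
  -- which leaves `δ = m/2`.
  set M := max M₀ 1
  have hM1 : 0 < M := lt_max_of_lt_right one_pos
  have hM : ∀ z ∈ D, ∑ i, ∑ k, ‖dz k (g i) z‖ ^ 2 ≤ M := fun z hz =>
    (hM₀ (Set.mem_image_of_mem _ hz)).trans (le_max_left _ _)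
  refine ⟨2 * M / m, m / 2, by positivity, by positivity, fun a ha φ ψ hφ hψ hopt => ?_⟩
  subst hφ
  have ha0 : 0 < a := lt_of_lt_of_le (by positivity) ha
  have hδ : m / 2 ≤ m - M / a := by
    rw [div_le_iff₀ hinf] at ha
    have : M / a ≤ m / 2 := by
      rw [div_le_div_iff₀ ha0 two_pos]
      linarith
    linarith
  have hq : Continuous (quadraticWeight n a) := (contDiff_quadraticWeight a).continuous
  have hθ : IsWeight D (quadraticWeight n a + ψ) :=
    ((hq.upperSemicontinuous.upperSemicontinuousOn D).add hψ).isWeight hD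
  refine ⟨fun hψc u hu v hv => ?_, fun f hf hfL => exists_holomorphic_division hopt ha0 hθ
    (memLp_top_of_bounded hD _ hg hsup) hg hm hM (lt_of_lt_of_le (by positivity) hδ) hf hfL⟩
  -- The continuity of `ψ` enters only here.
  have hd := dense_T₂_domain (p := p) hθ (hq.continuousOn.add hψc)
  have hu0 : IsWeakDbar D (u : L2 D (quadraticWeight n a + ψ)) 0 := by
    have h1 := hθ.isWeakDbar_dbar u
    rw [hu] at h1
    refine h1.congr Filter.EventuallyEq.rfl fun j => ?_
    rw [← hθ.ae_eq]
    exact Lp.coeFn_zero _ _ _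
  exact (mul_le_mul_of_nonneg_right hδ (by positivity)).trans
    (le_norm_sq_adjoint_add_adjoint hopt ha0 hθ (memLp_top_of_bounded hD _ hg hsup) hg hm hM hd hu0 v
      (isDbarClosed_of_orthogonal hθ hd hv))
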